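/- Setting. Let $\mathfrak g_{\mathbf C}$ be a complex Lie algebra with a basis $\{J_b\}_{b\in I}$ whose members are homogeneous for weights $\mathrm{wt}(b)$ in a root lattice $\Lambda\cong\mathbf Z^r$ (coordinates with respect to finitely many simple roots): $[J_a,J_b]=i\sum_c f_{ab}{}^c J_c$ with $\mathrm{wt}(c)=\mathrm{wt}(a)+\mathrm{wt}(b)$ whenever $f_{ab}{}^c\neq0$; every $\mathrm{wt}(b)$ is positive ($b\succ0$: a nonzero combination of simple roots with nonnegative coefficients), zero, or negative; each weight has finite multiplicity. (This covers the complexified Lie algebras of compact simple groups, of centrally extended loop groups, and the Virasoro algebra.) In expressions such as $a+a_1+\dots+a_k=\alpha$ or $a+a_1+\dots+a_k\succ0$ an index stands for its weight. Let $\Phi_+=\{\alpha\in I:\alpha\succ0\}$. Fix $a\in I$. The components $\tilde u_a^\alpha$ $(\alpha\in\Phi_+)$ of the holomorphic vector field of left multiplication by $J_a$ in the coordinates $z_\alpha$ are defined by $$e^{\epsilon J_a}\exp\Big(\sum_{\alpha\in\Phi_+}z_\alpha J_\alpha\Big)=\exp\Big(\sum_{\alpha\in\Phi_+}(z_\alpha+\epsilon\,\tilde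 u_a^\alpha)J_\alpha\Big)\,f+O(\epsilon^2),\qquad(*)$$ where $f$ is a function of the generators $J_b$ with $b\not\succ0$. This is read as an identity modulo $\epsilon^2$ of formal power series in $z$ and $\epsilon$ with coefficients in the universal enveloping algebra of $\mathfrak g_{\mathbf C}$, the $\tilde u_a^\alpha$ being formal power series in $z$ such that each monomial occurs in only finitely many of them, and $f$ a power series with coefficients in the subalgebra generated by the $J_b$, $b\not\succ0$. Statement. For $\alpha\in\Phi_+$ put $$A_a(k,\alpha)=\{(a_1,\dots,a_k)\in\Phi_+^k: a+a_1+\dots+a_k=\alpha\},\qquad C_a(a_1,\dots,a_k)=i^k\sum_{b_1,\dots,b_{k-1}}f_{a_1a}{}^{b_1}f_{a_2b_1}{}^{b_2}\cdots f_{a_kb_{k-1}}{}^{\alpha}$$ (for $k=0$: $C_a()=1$ if $a$ and $\alpha$ are the same index and $0$ otherwise), $$\beta_{k,\lambda}=(-1)^{k+1}\sum_{l=0}^{k-\lambda}\frac{B_l}{l!\,(k-l)!},$$ where $B_l$ is the $l$th Bernoulli number ($B_1=-\tfrac12$), and for $(a_1,\dots,a_k)\in A_a(k,\alpha)$ let $\lambda$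 be the least integer $\ge0$ with $a+a_1+\dots+a_\lambda\succ0$. Then: 1. For each $\alpha$ the set $\bigcup_{k\ge0}A_a(k,\alpha)$ is finite, and $\lambda$ is well defined with $\lambda\le k$ on $A_a(k,\alpha)$. 2. A family $(\tilde u_a^\alpha)_{\alpha\in\Phi_+}$ satisfies $(*)$ if and only if, for all $\alpha\in\Phi_+$, $$\tilde u_a^\alpha=-\sum_{k\ge0}\ \sum_{(a_1,\dots,a_k)\in A_a(k,\alpha)}\beta_{k,\lambda}\,C_a(a_1,\dots,a_k)\,z_{a_1}\cdots z_{a_k}.$$ 3. Consequently the vector field $\xi_a=-\sum_\alpha\tilde u_a^\alpha\,\partial/\partial z_\alpha$ acts on polynomials in the $z_\alpha$ as $$\xi_a=\sum_{\alpha\in\Phi_+}\ \sum_{k\ge0}\ \sum_{(a_1,\dots,a_k)\in A_a(k,\alpha)}\beta_{k,\lambda}\,C_a(a_1,\dots,a_k)\,z_{a_1}\cdots z_{a_k}\,\frac{\partial}{\partial z_\alpha},$$ where only finitely many terms act nontrivially on a given polynomial. 4. If $\mathfrak g_{\mathbf C}$ is finite-dimensional, the same holds in actual linear groups: for every injective Lie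 algebra homomorphism $\rho$ of $\mathfrak g_{\mathbf C}$ into a complex Banach algebra, every point $z\in\mathbf C^{\Phi_+}$ and every $v\in\mathbf C^{\Phi_+}$, one has $$e^{\epsilon\rho(J_a)}e^{\rho(\sum z_\alpha J_\alpha)}=e^{\rho(\sum(z_\alpha+\epsilon v^\alpha)J_\alpha)}\,e^{\rho(y(\epsilon))}+O(\epsilon^2)\quad(\epsilon\to0)$$ for some $y(\epsilon)\in\mathrm{span}\{J_b:b\not\succ0\}$ with $\rho(y(\epsilon))\to0$ if and only if $v^\alpha=\tilde u_a^\alpha(z)$ for all $\alpha$, with $\tilde u_a^\alpha$ the polynomial of part 2. -/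

import Mathlib

open scoped Topology Nat

-- associative algebras carry the commutator bracket
attribute [local instance 100] LieRing.ofAssociativeRing

noncomputable section

namespace CoadjointOrbit

variable {L : Type*} [LieRing L] [LieAlgebra ℂ L] {I : Type*} {Δ : Type*}

/-- The combinatorial data of a root decomposition of a complex Lie algebra `L`: a basis `J` of `L`
whose members are homogeneous for weights `wt b` in the root lattice `Δ → ℤ` (coordinates with
respect to the simple roots `Δ`). Members of weight `0` span the Cartan subalgebra (including
central elements), and every other weight is a nonnegative or a nonpositive combination of simple
roots. Weight spaces are finite dimensional. -/
structure IsRootBasis (J : Module.Basis I ℂ L) (wt : I → Δ → ℤ) : Prop where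
  /-- Weights add under the bracket. -/
  wt_bracket : ∀ a b c, J.repr ⁅J a, J b⁆ c ≠ 0 → wt c = wt a + wt b
  /-- Each basis element is positive, of weight zero, or negative. -/
  wt_sign : ∀ b, 0 < wt b ∨ wt b = 0 ∨ wt b < 0
  /-- Each weight has finite multiplicity. -/
  finite_mult : ∀ w, {b | wt b = w}.Finite

/-- The index set `Φ₊` of the generators `J_α` with `α ≻ 0`. -/
abbrev Pos (wt : I → Δ → ℤ) : Type _ := {b : I // 0 < wt b}

/-! ### The closed formula -/

/-- Structure constants `f_{ab}^c` in the convention `[J_a, J_b] = i ∑_c f_{ab}^c J_c`. -/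
def structConst (J : Module.Basis I ℂ L) (a b : I) : I →₀ ℂ :=
  (-Complex.I) • J.repr ⁅J a, J b⁆

/-- `∑_{b_1, …, b_{k-1}} f_{a_1 a}^{b_1} f_{a_2 b_1}^{b_2} ⋯ f_{a_k b_{k-1}}^α`, for a list
`[a_1, …, a_k]`; for `k = 0` it is the Kronecker delta of `a` and `α`. -/
def structChain (J : Module.Basis I ℂ L) (α : I) : I → List I → ℂ
  | a, [] => J.repr (J a) α
  | a, a₁ :: l => (structConst J a₁ a).sum fun b x => x * structChain J α b l

variable {wt : I → Δ → ℤ}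

/-- `C_a(a_1, …, a_k)` (with final upper index `α`). -/
def coeffC (J : Module.Basis I ℂ L) (a : I) (l : List (Pos wt)) (α : I) : ℂ :=
  Complex.I ^ l.length * structChain J α a (l.map Subtype.val)

variable (wt) in
/-- The weight `a + a_1 + ⋯ + a_k`. -/
def totalWeight (a : I) (l : List (Pos wt)) : Δ → ℤ :=
  wt a + (l.map fun b => wt b.1).sum

variable (wt) in
/-- The tuples (of any length `k ≥ 0`) of positive `a_1, …, a_k` with
`a + a_1 + ⋯ + a_k = α`. -/
def tuples (a : I) (α : Pos wt) : Set (List (Pos wt)) :=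
  {l | totalWeight wt a l = wt α.1}

variable (wt) in
/-- `λ`: the least integer such that `a + a_1 + ⋯ + a_λ ≻ 0`. -/
def crossing (a : I) (l : List (Pos wt)) : ℕ :=
  sInf {s : ℕ | s ≤ l.length ∧ 0 < totalWeight wt a (l.take s)}

/-- `β_{k,λ} = (-1)^{k+1} ∑_{l=0}^{k-λ} B_l / (l! (k-l)!)`, where `B_1 = -1/2`. -/
def beta (k lam : ℕ) : ℚ :=
  (-1) ^ (k + 1) * ∑ l ∈ Finset.range (k - lam + 1), bernoulli l / ((l ! : ℚ) * ((k - l)! : ℚ))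

/-- The term `β_{k,λ} C_a(a_1, …, a_k) z_{a_1} ⋯ z_{a_k}`. -/
def term (J : Module.Basis I ℂ L) (a : I) (l : List (Pos wt)) (α : Pos wt) :
    MvPolynomial (Pos wt) ℂ :=
  MvPolynomial.C ((beta l.length (crossing wt a l) : ℂ) * coeffC J a l α.1) *
    (l.map MvPolynomial.X).prod

variable (wt) in
/-- The closed formula for `ũ_a^α`. -/
def formula (J : Module.Basis I ℂ L) (a : I) (α : Pos wt) : MvPolynomial (Pos wt) ℂ :=
  -∑ᶠ l ∈ tuples wt a α, term J a l α

/-! ### The formal group: power series with coefficients in the enveloping algebra -/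

/-- The exponential `∑ Xⁿ / n!` of a formal power series without constant term over a (possibly
noncommutative) algebra; only `n ≤ deg m` contribute to the coefficient of the monomial `m`. -/
def formalExp {σ A : Type*} [Ring A] [Algebra ℂ A] (X : MvPowerSeries σ A) : MvPowerSeries σ A :=
  fun m => ∑ n ∈ Finset.range (m.degree + 1), ((n ! : ℂ)⁻¹) • MvPowerSeries.coeff m (X ^ n)

/-- Power series in the coordinates `z_α` (`some α`) and in the parameter `ε` (`none`), with
coefficients in the universal enveloping algebra. -/
abbrev FormalGroupRing (L : Type*) [LieRing L] [LieAlgebra ℂ L] (wt : I → Δ → ℤ) : Type _ :=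
  MvPowerSeries (Option (Pos wt)) (UniversalEnvelopingAlgebra ℂ L)

/-- The formal parameter `ε`. -/
def formalEps (L : Type*) [LieRing L] [LieAlgebra ℂ L] (wt : I → Δ → ℤ) :
    FormalGroupRing L wt :=
  MvPowerSeries.X none

/-- The Lie algebra generator `J_b` as a constant power series. -/
def gen (wt : I → Δ → ℤ) (J : Module.Basis I ℂ L) (b : I) : FormalGroupRing L wt :=
  MvPowerSeries.C (UniversalEnvelopingAlgebra.ι ℂ (J b))

open Classical in
/-- `∑_{α ≻ 0} v^α J_α`, for power series `v^α` in the `z`'s such that every monomial occurs in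
only finitely many of them. -/
def genSum (J : Module.Basis I ℂ L) (v : Pos wt → MvPowerSeries (Pos wt) ℂ) :
    FormalGroupRing L wt :=
  fun m => if m none = 0 then
    ∑ᶠ α : Pos wt, MvPowerSeries.coeff m.some (v α) • UniversalEnvelopingAlgebra.ι ℂ (J α.1)
  else 0

variable (wt) in
/-- The subalgebra of `U(L)` generated by the `J_b` with `b ⪯ 0`, that is `U(𝔟⁻)`. -/
def nonposSubalgebra (J : Module.Basis I ℂ L) : Subalgebra ℂ (UniversalEnvelopingAlgebra ℂ L) :=
  Algebra.adjoin ℂ {x | ∃ b, ¬ 0 < wt b ∧ x = UniversalEnvelopingAlgebra.ι ℂ (J b)}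

/-- `u` is the family of components `ũ_a^α` of the vector field of left multiplication by `J_a` in
the coordinates `z_α`:
`exp(ε J_a) exp(∑ z_α J_α) = exp(∑ (z_α + ε u^α) J_α) · F + O(ε²)`, where `F` is a function of the
generators `J_b`, `b ⪯ 0`, (depending on `z` and `ε`). -/
def IsFieldComponents (J : Module.Basis I ℂ L) (a : I)
    (u : Pos wt → MvPowerSeries (Pos wt) ℂ) : Prop :=
  (∀ m, {α | MvPowerSeries.coeff m (u α) ≠ 0}.Finite) ∧
  ∃ F : FormalGroupRing L wt,
    (∀ m, MvPowerSeries.coeff m F ∈ nonposSubalgebra wt J) ∧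
    ∀ m : Option (Pos wt) →₀ ℕ, m none ≤ 1 →
      MvPowerSeries.coeff m
        (formalExp (formalEps L wt * gen wt J a) *
          formalExp (genSum J fun α => MvPowerSeries.X α)) =
      MvPowerSeries.coeff m
        (formalExp (genSum J (fun α => MvPowerSeries.X α) + formalEps L wt * genSum J u) * F)

/-- The vector field `ξ = -∑_α u^α ∂/∂z_α` acting on polynomials in the `z_α`. -/
def vectorField (u : Pos wt → MvPowerSeries (Pos wt) ℂ) (p : MvPolynomial (Pos wt) ℂ) :
    MvPowerSeries (Pos wt) ℂ :=
  -∑ α ∈ p.vars, u α * (MvPolynomial.pderiv α p : MvPolynomial (Pos wt) ℂ)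

/-! ### Honest groups: exponentials in a Banach algebra -/

open Asymptotics in
/-- At the point with coordinates `z`, the numbers `v^α` are the order `ε` shifts of the coordinates
under left multiplication by `exp(ε J_a)`, in the group generated by the exponentials of `ρ(L)`:
`exp(ε J_a) exp(∑ z_α J_α) = exp(∑ (z_α + ε v^α) J_α) · exp(y(ε)) + O(ε²)` with `y(ε) → 0` in the
span `𝔟⁻` of the `J_b`, `b ⪯ 0`. -/
def IsCoordShift {A : Type*} [NormedRing A] [NormedAlgebra ℂ A] [Fintype (Pos wt)]
    (J : Module.Basis I ℂ L) (ρ : L →ₗ⁅ℂ⁆ A) (a : I) (z v : Pos wt → ℂ) : Prop :=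
  ∃ y : ℂ → L,
    (∀ ε, y ε ∈ Submodule.span ℂ {x | ∃ b, ¬ 0 < wt b ∧ x = J b}) ∧
    Filter.Tendsto (fun ε => ρ (y ε)) (𝓝 0) (𝓝 0) ∧
    (fun ε : ℂ =>
      NormedSpace.exp (ε • ρ (J a)) * NormedSpace.exp (ρ (∑ α, z α • J α.1)) -
        NormedSpace.exp (ρ (∑ α, (z α + ε * v α) • J α.1)) * NormedSpace.exp (ρ (y ε)))
      =O[𝓝 0] fun ε => ε ^ 2

end CoadjointOrbit

end

/-! Put Z = ∑ z_α J_α, X = -ad Z and V = ∑ ũ^α J_α. Modulo ε² one has J_a e^Z = e^Z · e^X(J_a) and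
e^{Z+εV} = e^Z (1 + ε φ(X)V) with φ(x) = (eˣ - 1)/x (`modEps_mul_formalExp`,
`modEps_formalExp_add`). Cancelling e^Z forces the right-hand factor to be 1 + ε (e^X J_a - φ(X)V).
So the defining equation says that e^X J_a - φ(X)V has no positive components
(`IsRootBasis.isFieldComponents_iff`). As φ(X)V has only positive components, this means φ(X)V =
P(e^X J_a), with P the projection onto the positive part. The unique solution is V = φ(X)⁻¹ P e^X
J_a, where 1/φ = x/(eˣ - 1) = ∑ B_l xˡ/l!.

The closed formula is the expansion of this in words a_1 ⋯ a_k: each factor X appends a letter with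
a sign, and nested brackets are homogeneous, so P keeps or kills a whole word. In a word of length k
the last l letters come from φ(X)⁻¹ and the prefix of length k - l from e^X; the prefix survives P
iff k - l ≥ λ. The coefficient is (-1)^k ∑_{l ≤ k-λ} B_l/(l!(k-l)!) = -β_{k,λ} (`fieldWord_eq`).

Two points need care. An element of the Lie algebra lying in U(𝔟⁻) must lie in 𝔟⁻; this is detected
by a representation extended by the height derivation (`IsRootBasis.ι_mem_nonposSubalgebra_iff`).
And the series in X must make sense: `IsSeriesApply` treats them over any filtration that X raises,
and is used for words, for power series with values in the Lie algebra or its enveloping algebra,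
and for a finite-dimensional algebra filtered by height. The linear maps `chainSeries`, `emb` and
`chainSum` intertwine the operators X and transport identities. In a Banach algebra the same linear
equation is reached by analysis (`exists_exp_isBigO_iff`). -/

namespace CoadjointOrbit

/-! ### Power series in a filtration-raising endomorphism -/

section Filtration

variable {M : Type*} [AddCommGroup M] [Module ℂ M]

/-- `s` is the sum of the series `∑ Y k` with respect to the filtration `F`. -/
def IsFilSum (F : ℕ → Submodule ℂ M) (Y : ℕ → M) (s : M) : Prop :=
  ∀ K, s - ∑ k ∈ Finset.range K, Y k ∈ F K

/-- `g = c(X) f`, the power series `c` in the endomorphism `X` being summed with respect to the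
filtration `F`. -/
def IsSeriesApply (F : ℕ → Submodule ℂ M) (X : Module.End ℂ M) (c : PowerSeries ℂ) (f g : M) :
    Prop :=
  IsFilSum F (fun k => PowerSeries.coeff k c • (X ^ k) f) g

variable {F : ℕ → Submodule ℂ M}

theorem IsFilSum.congr {Y Y' : ℕ → M} {s : M} (h : IsFilSum F Y s)
    (hY : ∀ k K, Y k - Y' k ∈ F K) : IsFilSum F Y' s := by
  intro K
  have h1 : ∑ k ∈ Finset.range K, (Y k - Y' k) ∈ F K := Submodule.sum_mem _ fun k _ => hY k K
  have h2 := add_mem (h K) h1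
  rw [Finset.sum_sub_distrib] at h2
  convert h2 using 1
  abel

theorem IsFilSum.sub_mem {Y : ℕ → M} {s s' : M} (h : IsFilSum F Y s) (h' : IsFilSum F Y s')
    (K : ℕ) : s - s' ∈ F K := by
  have := (F K).sub_mem (h K) (h' K)
  convert this using 1
  abel

theorem IsFilSum.add {Y Y' : ℕ → M} {s s' : M} (h : IsFilSum F Y s) (h' : IsFilSum F Y' s') :
    IsFilSum F (fun k => Y k + Y' k) (s + s') := by
  intro K
  have := (F K).add_mem (h K) (h' K)
  rw [Finset.sum_add_distrib]
  convert this using 1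
  abel

theorem IsFilSum.map {M' : Type*} [AddCommGroup M'] [Module ℂ M'] {F' : ℕ → Submodule ℂ M'}
    (T : M →ₗ[ℂ] M') (hT : ∀ K, ∀ f ∈ F K, T f ∈ F' K) {Y : ℕ → M} {s : M}
    (h : IsFilSum F Y s) : IsFilSum F' (fun k => T (Y k)) (T s) := by
  intro K
  have := hT K _ (h K)
  simpa using this

theorem pow_mem_filtration {X : Module.End ℂ M} (hX : ∀ n, ∀ f ∈ F n, X f ∈ F (n + 1))
    (i n : ℕ) {f : M} (hf : f ∈ F n) : (X ^ i) f ∈ F (i + n) := by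
  induction i with
  | zero => simpa using hf
  | succ i ih =>
    rw [pow_succ', Module.End.mul_apply, add_right_comm]
    exact hX _ _ ih

theorem IsSeriesApply.map {M' : Type*} [AddCommGroup M'] [Module ℂ M']
    {F' : ℕ → Submodule ℂ M'} (T : M →ₗ[ℂ] M') (hT : ∀ K, ∀ f ∈ F K, T f ∈ F' K)
    {X : Module.End ℂ M} {X' : Module.End ℂ M'} (hX : ∀ f, T (X f) = X' (T f))
    {c : PowerSeries ℂ} {f g : M} (h : IsSeriesApply F X c f g) :
    IsSeriesApply F' X' c (T f) (T g) := by
  have h1 : ∀ k f, T ((X ^ k) f) = (X' ^ k) (T f) := by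
    intro k
    induction k with
    | zero => simp
    | succ k ih => intro f; rw [pow_succ, pow_succ, Module.End.mul_apply, ih, hX]; rfl
  have := IsFilSum.map T hT h
  simpa only [IsSeriesApply, map_smul, h1] using this

/-- Since Xⁱ maps `F (K - i)` into `F K`, the inner series may be truncated at K - i inside the i-th
outer term; what remains is the Cauchy product of the coefficients. -/
theorem IsSeriesApply.comp {X : Module.End ℂ M} (hX : ∀ n, ∀ f ∈ F n, X f ∈ F (n + 1))
    {c d : PowerSeries ℂ} {f g h : M} (hc : IsSeriesApply F X c f g)
    (hd : IsSeriesApply F X d g h) : IsSeriesApply F X (d * c) f h := by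
  intro K
  have h1 : ∑ i ∈ Finset.range K, PowerSeries.coeff i d • (X ^ i)
      (g - ∑ j ∈ Finset.range (K - i), PowerSeries.coeff j c • (X ^ j) f) ∈ F K := by
    refine Submodule.sum_mem _ fun i hi => Submodule.smul_mem _ _ ?_
    have := pow_mem_filtration hX i _ (hc (K - i))
    rwa [Nat.add_sub_cancel' (Finset.mem_range.1 hi).le] at this
  have h2 := add_mem (hd K) h1
  convert h2 using 1
  simp only [map_sub, smul_sub, Finset.sum_sub_distrib, map_sum, Finset.smul_sum, map_smul]
  rw [sub_add_sub_cancel, ← Finset.sum_range_diag_flip K (fun i j =>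
    PowerSeries.coeff i d • PowerSeries.coeff j c • (X ^ i) ((X ^ j) f))]
  congr 1
  refine Finset.sum_congr rfl fun k _ => ?_
  rw [PowerSeries.coeff_mul, Finset.Nat.sum_antidiagonal_eq_sum_range_succ
    (fun i j => PowerSeries.coeff i d * PowerSeries.coeff j c), Finset.sum_smul]
  refine Finset.sum_congr rfl fun i hi => ?_
  rw [mul_smul, ← Module.End.mul_apply, ← pow_add,
    Nat.add_sub_cancel' (Nat.lt_succ_iff.1 (Finset.mem_range.1 hi))]

theorem isSeriesApply_one {X : Module.End ℂ M} (hF : F 0 = ⊤) (f : M) :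
    IsSeriesApply F X 1 f f := by
  intro K
  cases K with
  | zero => simp [hF]
  | succ K =>
    rw [Finset.sum_range_succ', Finset.sum_eq_zero]
    · simp
    · intro k _
      simp [PowerSeries.coeff_one]

theorem IsSeriesApply.eq {X : Module.End ℂ M} (hF : ∀ f, (∀ K, f ∈ F K) → f = 0)
    {c : PowerSeries ℂ} {f g g' : M} (h : IsSeriesApply F X c f g)
    (h' : IsSeriesApply F X c f g') : g = g' :=
  sub_eq_zero.1 (hF _ fun K => IsFilSum.sub_mem h h' K)

/-- If `d = c⁻¹`, and both `c(X) f` and `d(X) g` exist, then `c(X) f = g ↔ f = d(X) g`. -/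
theorem IsSeriesApply.eq_iff {X : Module.End ℂ M} (hX : ∀ n, ∀ f ∈ F n, X f ∈ F (n + 1))
    (hF : F 0 = ⊤) (hF' : ∀ f, (∀ K, f ∈ F K) → f = 0) {c d : PowerSeries ℂ} (hcd : d * c = 1)
    {f f' g g' : M} (h : IsSeriesApply F X c f f') (h' : IsSeriesApply F X d g g') :
    f' = g ↔ f = g' := by
  constructor
  · rintro rfl
    have := h.comp hX h'
    rw [hcd] at this
    exact (isSeriesApply_one hF f).eq hF' this
  · rintro rfl
    have := h'.comp hX h
    rw [mul_comm, hcd] at this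
    exact ((isSeriesApply_one hF g).eq hF' this).symm

end Filtration

/-! ### Noncommutative binomial identities for powers and their derivatives -/

section Ring

variable {R : Type*} [Ring R] [Algebra ℂ R]

/-- A filtration of an algebra by two-sided ideals. -/
structure IsRingFiltration (F : ℕ → Submodule ℂ R) : Prop where
  zero : F 0 = ⊤
  mul_mem : ∀ p q, ∀ x ∈ F p, ∀ y ∈ F q, x * y ∈ F (p + q)

/-- The error of the Cauchy product below K is (s - ∑ Y_i) s' + ∑ Y_i (s' - ∑_{j < K-i} Y'_j), so
only the first factor needs terms of increasing order. -/
theorem IsFilSum.mul {F : ℕ → Submodule ℂ R} (hF : IsRingFiltration F) {Y Y' : ℕ → R} {s s' : R}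
    (h : IsFilSum F Y s) (h' : IsFilSum F Y' s') (hY : ∀ n, Y n ∈ F n) :
    IsFilSum F (fun n => ∑ k ∈ Finset.range (n + 1), Y k * Y' (n - k)) (s * s') := by
  intro K
  have h1 : (s - ∑ k ∈ Finset.range K, Y k) * s' ∈ F K := by
    have := hF.mul_mem K 0 _ (h K) s' (by simp [hF.zero])
    simpa using this
  have h2 : ∑ i ∈ Finset.range K, Y i * (s' - ∑ j ∈ Finset.range (K - i), Y' j) ∈ F K := by
    refine Submodule.sum_mem _ fun i hi => ?_
    have := hF.mul_mem i (K - i) _ (hY i) _ (h' (K - i))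
    rwa [Nat.add_sub_cancel' (Finset.mem_range.1 hi).le] at this
  rw [Finset.sum_range_diag_flip K (fun i j => Y i * Y' j)]
  convert add_mem h1 h2 using 1
  simp only [mul_sub, sub_mul, Finset.sum_sub_distrib, Finset.mul_sum, Finset.sum_mul]
  abel

theorem IsFilSum.const_mul {F : ℕ → Submodule ℂ R} (hF : IsRingFiltration F) {Y : ℕ → R} {s : R}
    (x : R) (h : IsFilSum F Y s) : IsFilSum F (fun n => x * Y n) (x * s) := by
  intro K
  have := hF.mul_mem 0 K x (by simp [hF.zero]) _ (h K)
  simpa [mul_sub, Finset.mul_sum] using this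

/-- The endomorphism `-ad Z` of an associative algebra. -/
def negAd (Z : R) : Module.End ℂ R := LinearMap.mulRight ℂ Z - LinearMap.mulLeft ℂ Z

theorem negAd_apply (Z x : R) : negAd Z x = x * Z - Z * x := rfl

/-- Moving an element to the right of a power. -/
theorem mul_pow_eq_sum (Z V : R) (n : ℕ) :
    V * Z ^ n = ∑ q ∈ Finset.range (n + 1), (n.choose q : ℂ) • (Z ^ (n - q) * (negAd Z ^ q) V) := by
  -- Right multiplication by Z is `negAd Z` plus left multiplication by Z, and these commute: the
  -- ordinary binomial theorem applies in the endomorphism ring.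
  have hc : Commute (negAd Z) (LinearMap.mulLeft ℂ Z) :=
    ((LinearMap.commute_mulLeft_right Z Z).symm).sub_left (Commute.refl _)
  have h := congrArg (fun T : Module.End ℂ R => T V) (hc.add_pow' n)
  have h0 : negAd Z + LinearMap.mulLeft ℂ Z = LinearMap.mulRight ℂ Z := by
    rw [negAd, sub_add_cancel]
  simp only [h0, LinearMap.pow_mulRight] at h
  rw [LinearMap.mulRight_apply] at h
  rw [h, Finset.Nat.sum_antidiagonal_eq_sum_range_succ
    (fun i j => n.choose i • (negAd Z ^ i * LinearMap.mulLeft ℂ Z ^ j)), LinearMap.sum_apply]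
  refine Finset.sum_congr rfl fun q _ => ?_
  rw [(hc.pow_pow q (n - q)).eq, LinearMap.pow_mulLeft, LinearMap.smul_apply,
    Module.End.mul_apply, LinearMap.mulLeft_apply, Nat.cast_smul_eq_nsmul]

/-- The derivative of `Zⁿ` in the direction `V`. -/
def powDeriv (Z V : R) : ℕ → R
  | 0 => 0
  | n + 1 => Z * powDeriv Z V n + V * Z ^ n

/-- Moving V to the right in V Zⁿ produces the coefficients C(n,q), which join the C(n,q+1) of the
inductive hypothesis by Pascal's rule. -/
theorem powDeriv_eq_sum (Z V : R) (n : ℕ) :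
    powDeriv Z V n = ∑ q ∈ Finset.range n,
      (n.choose (q + 1) : ℂ) • (Z ^ (n - (q + 1)) * (negAd Z ^ q) V) := by
  induction n with
  | zero => simp [powDeriv]
  | succ n ih =>
    have h1 : Z * powDeriv Z V n = ∑ q ∈ Finset.range (n + 1),
        (n.choose (q + 1) : ℂ) • (Z ^ (n - q) * (negAd Z ^ q) V) := by
      rw [Finset.sum_range_succ, Nat.choose_succ_self, ih, Finset.mul_sum]
      simp only [Nat.cast_zero, zero_smul, add_zero]
      refine Finset.sum_congr rfl fun q hq => ?_
      have : n - q = (n - (q + 1)) + 1 := by have := Finset.mem_range.1 hq; omega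
      rw [this, pow_succ', mul_smul_comm, mul_assoc]
    rw [powDeriv, h1, mul_pow_eq_sum, ← Finset.sum_add_distrib]
    refine Finset.sum_congr rfl fun q _ => ?_
    rw [Nat.choose_succ_succ, Nat.succ_sub_succ, Nat.cast_add, add_smul, add_comm]

theorem choose_div_factorial {n q : ℕ} (h : q ≤ n) :
    ((n ! : ℂ)⁻¹) * (n.choose q : ℂ) = (((n - q)! : ℂ)⁻¹) * ((q ! : ℂ)⁻¹) := by
  have h1 := Nat.choose_mul_factorial_mul_factorial h
  have h2 : (n.choose q : ℂ) * q ! * (n - q)! = n ! := by exact_mod_cast h1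
  rw [← h2]
  have := Nat.factorial_ne_zero q
  have := Nat.factorial_ne_zero (n - q)
  have : n.choose q ≠ 0 := (Nat.choose_pos h).ne'
  field_simp

/-- The degree n part of V e^Z = e^Z · e^X V, written as a Cauchy product so that it serves both the
filtered sums and the convergent ones. -/
theorem mul_expTerm (Z V : R) (n : ℕ) :
    V * ((n ! : ℂ)⁻¹ • Z ^ n) = ∑ p ∈ Finset.range (n + 1),
      ((p ! : ℂ)⁻¹ • Z ^ p) * (((n - p)! : ℂ)⁻¹ • (negAd Z ^ (n - p)) V) := by
  rw [← Finset.sum_range_reflect, mul_smul_comm, mul_pow_eq_sum, Finset.smul_sum]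
  refine Finset.sum_congr rfl fun q hq => ?_
  have hq' : q ≤ n := Nat.lt_succ_iff.1 (Finset.mem_range.1 hq)
  have e1 : n + 1 - 1 - q = n - q := by omega
  have e2 : n - (n - q) = q := by omega
  rw [e1, e2, smul_mul_smul_comm, smul_smul, choose_div_factorial hq']

/-- The counterpart for the derivative of exp. The shift to n + 1 reflects that Z⁰ has derivative
zero and that φ(x) = ∑ xⁿ/(n+1)! starts one factorial later. -/
theorem powDeriv_expTerm (Z V : R) (n : ℕ) :
    ((n + 1)! : ℂ)⁻¹ • powDeriv Z V (n + 1) = ∑ p ∈ Finset.range (n + 1),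
      ((p ! : ℂ)⁻¹ • Z ^ p) * (((n - p + 1)! : ℂ)⁻¹ • (negAd Z ^ (n - p)) V) := by
  rw [← Finset.sum_range_reflect, powDeriv_eq_sum, Finset.smul_sum]
  refine Finset.sum_congr rfl fun q hq => ?_
  have hq' : q ≤ n := Nat.lt_succ_iff.1 (Finset.mem_range.1 hq)
  have e1 : n + 1 - 1 - q = n - q := by omega
  have e2 : n - (n - q) = q := by omega
  rw [e1, e2, smul_mul_smul_comm, smul_smul, choose_div_factorial (by omega : q + 1 ≤ n + 1),
    Nat.succ_sub_succ]

end Ring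

/-! ### The series eˣ, (eˣ - 1)/x and its inverse -/

section Series

/-- `∑ xⁿ / n!`. -/
noncomputable def expSeries : PowerSeries ℂ := PowerSeries.mk fun n => (n ! : ℂ)⁻¹

/-- `(eˣ - 1) / x`. -/
noncomputable def expQuotSeries : PowerSeries ℂ := PowerSeries.mk fun n => ((n + 1)! : ℂ)⁻¹

/-- `x / (eˣ - 1)`. -/
noncomputable def todd : PowerSeries ℂ := bernoulliPowerSeries ℂ

theorem coeff_todd (n : ℕ) : PowerSeries.coeff n todd = (bernoulli n : ℂ) * (n ! : ℂ)⁻¹ := by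
  simp [todd, bernoulliPowerSeries, div_eq_mul_inv]

/-- Cancel one factor x from the generating identity (∑ B_l xˡ/l!)(eˣ - 1) = x; this is the
convention B_1 = -1/2. -/
theorem todd_mul_expQuotSeries : todd * expQuotSeries = 1 := by
  have h : PowerSeries.exp ℂ - 1 = PowerSeries.X * expQuotSeries := by
    ext n
    cases n with
    | zero => simp
    | succ n =>
      rw [PowerSeries.coeff_succ_X_mul]
      simp [PowerSeries.coeff_exp, expQuotSeries, PowerSeries.coeff_one]
  have h1 := bernoulliPowerSeries_mul_exp_sub_one ℂ
  rw [h, mul_left_comm] at h1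
  exact mul_left_cancel₀ PowerSeries.X_ne_zero (h1.trans (mul_one _).symm)

end Series

variable {L : Type*} [LieRing L] [LieAlgebra ℂ L] {I : Type*} {Δ : Type*}
variable {J : Module.Basis I ℂ L} {wt : I → Δ → ℤ}

/-! ### Homogeneous components and the projection onto the positive part -/

section Weights

variable (wt) in
/-- The projection onto the span of the basis elements of positive weight. -/
noncomputable def posProj (J : Module.Basis I ℂ L) : L →ₗ[ℂ] L :=
  open Classical in J.constr ℂ fun b => if 0 < wt b then J b else 0

open Classical in
theorem repr_posProj (x : L) (c : I) :
    J.repr (posProj wt J x) c = if 0 < wt c then J.repr x c else 0 := by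
  have : J.coord c ∘ₗ posProj wt J = if 0 < wt c then J.coord c else 0 := by
    refine J.ext fun b => ?_
    rw [LinearMap.comp_apply, posProj, J.constr_basis]
    by_cases hbc : b = c
    · subst hbc
      split_ifs <;> simp
    · split_ifs <;> simp [hbc]
  have h := LinearMap.congr_fun this x
  split_ifs at h ⊢ <;> simpa using h

variable (wt) in
/-- The vectors all of whose components have weight `w`. -/
def weightSpace (J : Module.Basis I ℂ L) (w : Δ → ℤ) : Submodule ℂ L where
  carrier := {x | ∀ c, J.repr x c ≠ 0 → wt c = w}
  zero_mem' := by simp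
  add_mem' := by
    intro x y hx hy c hc
    by_cases h : J.repr x c = 0
    · exact hy c fun h' => hc (by simp [h, h'])
    · exact hx c h
  smul_mem' := by
    intro r x hx c hc
    exact hx c fun h' => hc (by simp [h'])

theorem basis_mem_weightSpace (b : I) : J b ∈ weightSpace wt J (wt b) := by
  classical
  intro c hc
  by_contra h
  exact hc (by rw [J.repr_self, Finsupp.single_apply, if_neg]; rintro rfl; exact h rfl)

theorem mem_weightSpace_iff_span {w : Δ → ℤ} {x : L} :
    x ∈ weightSpace wt J w ↔ x ∈ Submodule.span ℂ (J '' {b | wt b = w}) := by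
  rw [J.mem_span_image]
  constructor
  · intro h c hc
    exact h c (by simpa using hc)
  · intro h c hc
    exact h (by simpa using hc)

theorem IsRootBasis.lie_mem_weightSpace (hJ : IsRootBasis J wt) (b : I) {w : Δ → ℤ} {x : L}
    (hx : x ∈ weightSpace wt J w) : ⁅J b, x⁆ ∈ weightSpace wt J (wt b + w) := by
  rw [mem_weightSpace_iff_span] at hx
  induction hx using Submodule.span_induction with
  | mem x hx =>
    obtain ⟨c, rfl, rfl⟩ := hx
    exact fun d hd => hJ.wt_bracket b c d hd
  | zero => simp
  | add x y _ _ hx hy => rw [lie_add]; exact add_mem hx hy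
  | smul r x _ hx => rw [lie_smul]; exact Submodule.smul_mem _ _ hx

open Classical in
theorem posProj_of_mem_weightSpace {w : Δ → ℤ} {x : L} (hx : x ∈ weightSpace wt J w) :
    posProj wt J x = if 0 < w then x else 0 := by
  refine J.repr.injective (Finsupp.ext fun c => ?_)
  rw [repr_posProj]
  by_cases hc : J.repr x c = 0
  · split_ifs <;> simp [hc]
  · rw [hx c hc]
    split_ifs <;> simp

variable (wt) in
/-- The vectors without components of positive weight. -/
noncomputable def nonposSubmodule (J : Module.Basis I ℂ L) : Submodule ℂ L :=
  LinearMap.ker (posProj wt J)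

theorem mem_nonposSubmodule {x : L} :
    x ∈ nonposSubmodule wt J ↔ ∀ c, 0 < wt c → J.repr x c = 0 := by
  rw [nonposSubmodule, LinearMap.mem_ker]
  constructor
  · intro h c hc
    have := repr_posProj (J := J) (wt := wt) x c
    rw [h, if_pos hc] at this
    simpa using this.symm
  · intro h
    refine J.repr.injective (Finsupp.ext fun c => ?_)
    rw [repr_posProj]
    split_ifs with hc
    · simp [h c hc]
    · simp

theorem nonposSubmodule_eq_span :
    nonposSubmodule wt J = Submodule.span ℂ {x | ∃ b, ¬ 0 < wt b ∧ x = J b} := by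
  have : {x | ∃ b, ¬ 0 < wt b ∧ x = J b} = J '' {b | ¬ 0 < wt b} := by
    ext x
    simp only [Set.mem_ofPred_eq, Set.mem_image]
    exact ⟨fun ⟨b, h, e⟩ => ⟨b, h, e.symm⟩, fun ⟨b, h, e⟩ => ⟨b, h, e.symm⟩⟩
  ext x
  rw [this, J.mem_span_image, mem_nonposSubmodule]
  constructor
  · intro h c hc hc'
    simp only [Finset.mem_coe, Finsupp.mem_support_iff] at hc
    exact hc (h c hc')
  · intro h c hc
    by_contra h'
    exact h (by simpa using h') hc

theorem IsRootBasis.nonpos (hJ : IsRootBasis J wt) {b : I} (h : ¬ 0 < wt b) : wt b ≤ 0 := by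
  rcases hJ.wt_sign b with h' | h' | h'
  · exact absurd h' h
  · exact h'.le
  · exact h'.le

/-- The trichotomy of weights is needed: a weight that is not positive is ≤ 0, and such weights are
closed under addition. -/
theorem IsRootBasis.lie_mem_nonpos (hJ : IsRootBasis J wt) {b : I} (hb : ¬ 0 < wt b) {x : L}
    (hx : x ∈ nonposSubmodule wt J) : ⁅J b, x⁆ ∈ nonposSubmodule wt J := by
  rw [nonposSubmodule_eq_span] at hx
  induction hx using Submodule.span_induction with
  | mem x hx =>
    obtain ⟨c, hc, rfl⟩ := hx
    rw [mem_nonposSubmodule]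
    intro d hd
    by_contra h
    have := hJ.wt_bracket b c d h
    rw [this] at hd
    exact absurd (hd.trans_le (add_nonpos (hJ.nonpos hb) (hJ.nonpos hc))) (lt_irrefl _)
  | zero => simp
  | add x y _ _ hx hy => rw [lie_add]; exact add_mem hx hy
  | smul r x _ hx => rw [lie_smul]; exact Submodule.smul_mem _ _ hx

end Weights

/-! ### The height derivation and the intersection of U(𝔟⁻) with the Lie algebra -/

section Height

variable [Fintype Δ]

/-- The sum of the coordinates of a weight. -/
def height (w : Δ → ℤ) : ℤ := ∑ i, w i

theorem height_add (v w : Δ → ℤ) : height (v + w) = height v + height w := by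
  simp [height, Finset.sum_add_distrib]

theorem height_pos {w : Δ → ℤ} (h : 0 < w) : 0 < height w :=
  Fintype.sum_pos h

variable (wt) in
/-- The derivation multiplying each basis element by its height. -/
noncomputable def heightDer (J : Module.Basis I ℂ L) : L →ₗ[ℂ] L :=
  J.constr ℂ fun b => (height (wt b) : ℂ) • J b

theorem repr_heightDer (x : L) (c : I) :
    J.repr (heightDer wt J x) c = (height (wt c) : ℂ) * J.repr x c := by
  classical
  have : J.coord c ∘ₗ heightDer wt J = (height (wt c) : ℂ) • J.coord c := by
    refine J.ext fun b => ?_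
    rw [LinearMap.comp_apply, heightDer, J.constr_basis]
    by_cases hbc : b = c
    · subst hbc; simp
    · simp [hbc]
  simpa using LinearMap.congr_fun this x

/-- By bilinearity it suffices to treat basis vectors, where every nonzero component of the bracket
has height equal to the sum of the two heights. -/
theorem IsRootBasis.heightDer_lie (hJ : IsRootBasis J wt) (x y : L) :
    heightDer wt J ⁅x, y⁆ = ⁅heightDer wt J x, y⁆ + ⁅x, heightDer wt J y⁆ := by
  let D := heightDer wt J
  let br : L →ₗ[ℂ] L →ₗ[ℂ] L := (LieModule.toEnd ℂ L L : L →ₗ[ℂ] Module.End ℂ L)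
  have : br.compr₂ D = br ∘ₗ D + br.compl₂ D := by
    refine J.ext fun a => J.ext fun b => ?_
    change D ⁅J a, J b⁆ = ⁅D (J a), J b⁆ + ⁅J a, D (J b)⁆
    simp only [D, heightDer, J.constr_basis, smul_lie, lie_smul]
    rw [← add_smul]
    refine J.repr.injective (Finsupp.ext fun c => ?_)
    have h1 := repr_heightDer (J := J) (wt := wt) ⁅J a, J b⁆ c
    rw [heightDer] at h1
    rw [h1, map_smul, Finsupp.smul_apply, smul_eq_mul]
    by_cases hc : J.repr ⁅J a, J b⁆ c = 0
    · simp [hc]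
    · rw [hJ.wt_bracket a b c hc, height_add]
      push_cast
      rfl
  exact LinearMap.congr_fun₂ this x y

/-- The representation of `L` on `L × ℂ` obtained by adjoining the height derivation to the
adjoint representation. -/
noncomputable def IsRootBasis.extRep (hJ : IsRootBasis J wt) : L →ₗ⁅ℂ⁆ Module.End ℂ (L × ℂ) where
  -- The vector (0, 1) plays the role of the height derivation D, with [x, D] = -D(x). The adjoint
  -- representation alone would not see central elements.
  toFun x := LinearMap.prod
    ((LieModule.toEnd ℂ L L x) ∘ₗ LinearMap.fst ℂ L ℂ -
      (LinearMap.snd ℂ L ℂ).smulRight (heightDer wt J x)) 0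
  map_add' x y := by
    ext <;> simp
    abel
  map_smul' r x := by
    ext <;> simp
  map_lie' := by
    intro x y
    refine LinearMap.ext fun p => ?_
    simp only [LieRing.of_associative_ring_bracket]
    refine Prod.ext ?_ ?_
    · have h : ⁅y, heightDer wt J x⁆ = -⁅heightDer wt J x, y⁆ := (lie_skew _ _).symm
      simp [hJ.heightDer_lie, smul_add]
      rw [h, smul_neg]
      abel
    · simp

theorem IsRootBasis.extRep_apply (hJ : IsRootBasis J wt) (x : L) (p : L × ℂ) :
    hJ.extRep x p = (⁅x, p.1⁆ - p.2 • heightDer wt J x, 0) := rfl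

theorem heightDer_mem_nonpos {x : L} :
    heightDer wt J x ∈ nonposSubmodule wt J ↔ x ∈ nonposSubmodule wt J := by
  simp only [mem_nonposSubmodule, repr_heightDer]
  refine forall₂_congr fun c hc => ?_
  have := (height_pos hc).ne'
  simp [this]

/-- The elements of `L` in `U(𝔟⁻)` lie in `𝔟⁻`. -/
theorem IsRootBasis.ι_mem_nonposSubalgebra_iff (hJ : IsRootBasis J wt) (x : L) :
    UniversalEnvelopingAlgebra.ι ℂ x ∈ nonposSubalgebra wt J ↔ x ∈ nonposSubmodule wt J := by
  constructor
  · intro hx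
    -- The subspace 𝔟⁻ × ℂ is stable under the generators of U(𝔟⁻), hence under all of it.
    have key : ∀ w ∈ nonposSubalgebra wt J, ∀ p : L × ℂ, p.1 ∈ nonposSubmodule wt J →
        (UniversalEnvelopingAlgebra.lift ℂ hJ.extRep w p).1 ∈ nonposSubmodule wt J := by
      intro w hw
      induction hw using Algebra.adjoin_induction with
      | mem w hw =>
        obtain ⟨b, hb, rfl⟩ := hw
        intro p hp
        rw [UniversalEnvelopingAlgebra.lift_ι_apply, hJ.extRep_apply]
        refine sub_mem (hJ.lie_mem_nonpos hb hp) (Submodule.smul_mem _ _ ?_)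
        rw [heightDer_mem_nonpos, nonposSubmodule_eq_span]
        exact Submodule.subset_span ⟨b, hb, rfl⟩
      | algebraMap r =>
        intro p hp
        rw [AlgHom.commutes, Module.algebraMap_end_apply]
        exact Submodule.smul_mem _ _ hp
      | add x y _ _ hx hy =>
        intro p hp
        rw [map_add]
        exact add_mem (hx p hp) (hy p hp)
      | mul x y _ _ hx hy =>
        intro p hp
        rw [map_mul]
        exact hx _ (hy p hp)
    -- Applied to D, the element x gives -D(x). Positive components have nonzero height, so D(x) ∈
    -- 𝔟⁻ forces x ∈ 𝔟⁻.
    have h := key _ hx (0, 1) (zero_mem _)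
    rw [UniversalEnvelopingAlgebra.lift_ι_apply, hJ.extRep_apply] at h
    simpa [heightDer_mem_nonpos] using h
  · intro hx
    rw [nonposSubmodule_eq_span] at hx
    induction hx using Submodule.span_induction with
    | mem x hx => exact Algebra.subset_adjoin (by obtain ⟨b, hb, rfl⟩ := hx; exact ⟨b, hb, rfl⟩)
    | zero => rw [map_zero]; exact zero_mem _
    | add x y _ _ hx hy => rw [map_add]; exact add_mem hx hy
    | smul r x _ hx => rw [map_smul]; exact Subalgebra.smul_mem _ hx r

end Height

/-! ### Words of positive letters: finiteness and the crossing index λ -/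

section Tuples

theorem totalWeight_nil (a : I) : totalWeight wt a [] = wt a := by simp [totalWeight]

theorem totalWeight_append (a : I) (l l' : List (Pos wt)) :
    totalWeight wt a (l ++ l') = totalWeight wt a l + (l'.map fun b => wt b.1).sum := by
  simp [totalWeight, add_assoc]

theorem sum_wt_nonneg (l : List (Pos wt)) : 0 ≤ (l.map fun b => wt b.1).sum :=
  List.sum_nonneg (by
    intro x hx
    obtain ⟨b, -, rfl⟩ := List.mem_map.1 hx
    exact b.2.le)

theorem totalWeight_take_mono (a : I) (l : List (Pos wt)) {m n : ℕ} (h : m ≤ n) :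
    totalWeight wt a (l.take m) ≤ totalWeight wt a (l.take n) := by
  have : l.take n = l.take m ++ (l.take n).drop m := by
    conv_lhs => rw [← List.take_append_drop m (l.take n)]
    rw [List.take_take, min_eq_left h]
  rw [this, totalWeight_append]
  exact le_add_of_nonneg_right (sum_wt_nonneg _)

/-- The full word has the positive weight of α, so the bound s ≤ k in `crossing` excludes no smaller
candidate and the infimum is over a nonempty set. -/
theorem isLeast_crossing {a : I} {α : Pos wt} {l : List (Pos wt)} (hl : l ∈ tuples wt a α) :
    IsLeast {s : ℕ | 0 < totalWeight wt a (l.take s)} (crossing wt a l) ∧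
      crossing wt a l ≤ l.length := by
  have hne : {s : ℕ | s ≤ l.length ∧ 0 < totalWeight wt a (l.take s)}.Nonempty :=
    ⟨l.length, le_rfl, by rw [List.take_length, (hl : totalWeight wt a l = _)]; exact α.2⟩
  have hmem := Nat.sInf_mem hne
  refine ⟨⟨hmem.2, fun s hs => ?_⟩, hmem.1⟩
  by_cases h : s ≤ l.length
  · exact Nat.sInf_le ⟨h, hs⟩
  · exact hmem.1.trans (le_of_not_ge h)

/-- Prefix weights increase with the prefix, so positivity persists once reached. This is what turns
the positive projection into a truncation of the Bernoulli sum. -/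
theorem take_pos_iff {a : I} {α : Pos wt} {l : List (Pos wt)} (hl : l ∈ tuples wt a α) (s : ℕ) :
    0 < totalWeight wt a (l.take s) ↔ crossing wt a l ≤ s := by
  obtain ⟨h, -⟩ := isLeast_crossing hl
  exact ⟨fun hs => h.2 hs, fun hs => h.1.trans_le (totalWeight_take_mono a l hs)⟩

theorem length_le_height [Fintype Δ] (l : List (Pos wt)) :
    (l.length : ℤ) ≤ height (l.map fun b => wt b.1).sum := by
  induction l with
  | nil => simp [height]
  | cons b l ih =>
    rw [List.map_cons, List.sum_cons, height_add, List.length_cons]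
    have := height_pos b.2
    push_cast
    linarith

/-- The letters sum to w = wt α - wt a. Each letter thus has weight in the finite box [0, w], where
multiplicities are finite, and has height at least 1, so the length is at most the height of w. -/
theorem IsRootBasis.finite_tuples [Finite Δ] (hJ : IsRootBasis J wt) (a : I) (α : Pos wt) :
    (tuples wt a α).Finite := by
  classical
  cases nonempty_fintype Δ
  set w := wt α.1 - wt a
  have hS : {b : Pos wt | wt b.1 ≤ w}.Finite := by
    have h1 : {b : I | wt b ∈ Set.Icc 0 w}.Finite := by
      have : {b : I | wt b ∈ Set.Icc 0 w} = ⋃ v ∈ Set.Icc 0 w, {b | wt b = v} := by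
        ext b; simp
      rw [this]
      exact (Set.finite_Icc _ _).biUnion fun v _ => hJ.finite_mult v
    refine Set.Finite.subset (h1.preimage (f := Subtype.val) Subtype.val_injective.injOn) ?_
    intro b hb
    exact ⟨b.2.le, hb⟩
  have h2 : {l : List (Pos wt) | l.length < (height w).toNat + 1 ∧ ∀ x ∈ l,
      x ∈ {b : Pos wt | wt b.1 ≤ w}}.Finite := by
    have : Finite {b : Pos wt | wt b.1 ≤ w} := hS
    refine ((List.finite_length_lt {b : Pos wt | wt b.1 ≤ w} ((height w).toNat + 1)).image
      (List.map Subtype.val)).subset ?_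
    rintro l ⟨hl, hl'⟩
    refine ⟨l.attach.map fun x => ⟨x.1, hl' _ x.2⟩, ?_, ?_⟩
    · change (l.attach.map _).length < _
      simpa using hl
    · rw [List.map_map]
      exact List.attach_map_subtype_val l
  refine h2.subset fun l hl => ?_
  have hw : (l.map fun b => wt b.1).sum = w := by
    have : totalWeight wt a l = wt α.1 := hl
    rw [← sub_eq_of_eq_add' this.symm]
  refine ⟨?_, fun x hx => ?_⟩
  · have := length_le_height l
    rw [hw] at this
    omega
  · change wt x.1 ≤ w
    rw [← hw]
    exact List.single_le_sum (by
      intro v hv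
      obtain ⟨b, -, rfl⟩ := List.mem_map.1 hv
      exact b.2.le) _ (List.mem_map.2 ⟨x, hx, rfl⟩)

end Tuples

/-! ### Iterated brackets and structure constants -/

section Chain

/-- The iterated bracket `[J_{a_k}, …, [J_{a_1}, x]]`. -/
noncomputable def chain (J : Module.Basis I ℂ L) : L → List (Pos wt) → L
  | x, [] => x
  | x, b :: l => chain J ⁅J b.1, x⁆ l

theorem chain_append (x : L) (l l' : List (Pos wt)) :
    chain J x (l ++ l') = chain J (chain J x l) l' := by
  induction l generalizing x with
  | nil => rfl
  | cons b l ih => exact ih _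

/-- The last letter is the outermost bracket, so applying ad J_b amounts to appending b. -/
theorem chain_concat (x : L) (l : List (Pos wt)) (b : Pos wt) :
    chain J x (l ++ [b]) = ⁅J b.1, chain J x l⁆ := by
  rw [chain_append]; rfl

/-- `chain` as a linear map of its first argument. -/
noncomputable def chainLin (J : Module.Basis I ℂ L) : List (Pos wt) → L →ₗ[ℂ] L
  | [] => LinearMap.id
  | b :: l => chainLin J l ∘ₗ (LieModule.toEnd ℂ L L (J b.1))

theorem chainLin_apply (l : List (Pos wt)) (x : L) : chainLin J l x = chain J x l := by
  induction l generalizing x with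
  | nil => rfl
  | cons b l ih => exact ih _

/-- Every bracket contributes one factor i f, so the power of i cancels the factors -i in
`structConst` and leaves the plain coordinate of the nested bracket. -/
theorem coeffC_eq (a : I) (l : List (Pos wt)) (α : I) :
    coeffC J a l α = J.repr (chain J (J a) l) α := by
  induction l generalizing a with
  | nil => simp [coeffC, structChain, chain]
  | cons b l ih =>
    have h1 : J.repr (chain J ⁅J b.1, J a⁆ l) α =
        (J.repr ⁅J b.1, J a⁆).sum fun c x => x * J.repr (chain J (J c) l) α := by
      rw [← chainLin_apply]
      conv_lhs => rw [← J.linearCombination_repr ⁅J b.1, J a⁆]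
      rw [Finsupp.linearCombination_apply, Finsupp.sum, map_sum, map_sum, Finsupp.finsetSum_apply]
      simp [Finsupp.sum, chainLin_apply]
    change _ = J.repr (chain J ⁅J b.1, J a⁆ l) α
    rw [h1, coeffC, List.map_cons, structChain, structConst, Finsupp.sum_smul_index (by simp),
      Finsupp.sum, Finsupp.sum, Finset.mul_sum]
    refine Finset.sum_congr rfl fun c _ => ?_
    rw [← ih, coeffC, List.length_cons, pow_succ]
    have : Complex.I * Complex.I = -1 := Complex.I_mul_I
    linear_combination (-Complex.I ^ l.length * J.repr ⁅J b.1, J a⁆ c *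
      structChain J α c (l.map Subtype.val)) * this

theorem IsRootBasis.chain_mem_weightSpace (hJ : IsRootBasis J wt) (a : I) (l : List (Pos wt)) :
    chain J (J a) l ∈ weightSpace wt J (totalWeight wt a l) := by
  induction l using List.reverseRecOn with
  | nil => rw [totalWeight_nil]; exact basis_mem_weightSpace a
  | append_singleton l b ih =>
    rw [chain_concat, totalWeight_append, add_comm]
    simpa using hJ.lie_mem_weightSpace b.1 ih

end Chain

/-! ### Formal exponentials modulo ε² -/

section EpsFiltration

variable {σ A : Type*} [Ring A] [Algebra ℂ A]

/-- Power series in `z` and `ε` of order `≥ n`, modulo `ε²`. -/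
def epsFiltration (n : ℕ) : Submodule ℂ (MvPowerSeries (Option σ) A) where
  carrier := {f | ∀ m : Option σ →₀ ℕ, m none ≤ 1 → m.degree < n → MvPowerSeries.coeff m f = 0}
  zero_mem' := by intro m _ _; simp
  add_mem' := by
    intro x y hx hy m h h'
    rw [map_add, hx m h h', hy m h h', add_zero]
  smul_mem' := by
    intro r x hx m h h'
    rw [← smul_one_smul A r x]
    simp [hx m h h']

theorem isRingFiltration_epsFiltration :
    IsRingFiltration (epsFiltration : ℕ → Submodule ℂ (MvPowerSeries (Option σ) A)) where
  zero := by
    ext f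
    simp only [Submodule.mem_top, iff_true]
    intro m _ h
    exact absurd h (Nat.not_lt_zero _)
  mul_mem := by
    classical
    intro p q x hx y hy m h h'
    rw [MvPowerSeries.coeff_mul]
    refine Finset.sum_eq_zero fun k hk => ?_
    rw [Finset.HasAntidiagonal.mem_antidiagonal] at hk
    have h1 : k.1 none + k.2 none = m none := by rw [← hk]; rfl
    have h2 : k.1.degree + k.2.degree = m.degree := by rw [← hk, map_add]
    by_cases h3 : k.1.degree < p
    · rw [hx k.1 (by omega) h3, zero_mul]
    · rw [hy k.2 (by omega) (by omega), mul_zero]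

theorem pow_mem_epsFiltration {x : MvPowerSeries (Option σ) A} (hx : x ∈ epsFiltration 1)
    (n : ℕ) : x ^ n ∈ epsFiltration n := by
  induction n with
  | zero => simp [isRingFiltration_epsFiltration.zero]
  | succ n ih => rw [pow_succ]; exact isRingFiltration_epsFiltration.mul_mem _ _ _ ih _ hx

/-- xⁿ has order at least n modulo ε², so the cut-off n ≤ deg m in `formalExp` discards only zero
terms at the monomials that matter. -/
theorem isFilSum_formalExp {x : MvPowerSeries (Option σ) A} (hx : x ∈ epsFiltration 1) :
    IsFilSum epsFiltration (fun n => (n ! : ℂ)⁻¹ • x ^ n) (formalExp x) := by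
  intro K m hm hK
  have hc : ∀ (r : ℂ) (f : MvPowerSeries (Option σ) A), MvPowerSeries.coeff m (r • f) =
    r • MvPowerSeries.coeff m f := fun _ _ => rfl
  rw [map_sub, map_sum, sub_eq_zero]
  simp only [hc]
  change ∑ n ∈ Finset.range (m.degree + 1), _ = _
  refine Finset.sum_subset (Finset.range_mono hK) fun n _ hn => ?_
  have hn' : m.degree < n := by
    rw [Finset.mem_range, not_lt] at hn
    exact hn
  have h : MvPowerSeries.coeff m (x ^ n) = 0 := pow_mem_epsFiltration hx n m hm hn'
  rw [h, smul_zero]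

/-- Congruence modulo `ε²`. -/
def epsCon (σ A : Type*) [Ring A] : RingCon (MvPowerSeries (Option σ) A) where
  r f g := ∀ m : Option σ →₀ ℕ, m none ≤ 1 → MvPowerSeries.coeff m f = MvPowerSeries.coeff m g
  iseqv := ⟨fun _ _ _ => rfl, fun h m hm => (h m hm).symm, fun h h' m hm =>
    (h m hm).trans (h' m hm)⟩
  add' := by
    intro w x y z h h' m hm
    rw [map_add, map_add, h m hm, h' m hm]
  mul' := by
    classical
    intro w x y z h h' m hm
    rw [MvPowerSeries.coeff_mul, MvPowerSeries.coeff_mul]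
    refine Finset.sum_congr rfl fun k hk => ?_
    rw [Finset.HasAntidiagonal.mem_antidiagonal] at hk
    have h1 : k.1 none + k.2 none = m none := by rw [← hk]; rfl
    rw [h k.1 (by omega), h' k.2 (by omega)]

variable (σ A) in
/-- The reduction modulo `ε²`. -/
noncomputable def modEps : MvPowerSeries (Option σ) A →+* (epsCon σ A).Quotient :=
  (epsCon σ A).mk'

omit [Algebra ℂ A] in
theorem modEps_eq_iff {f g : MvPowerSeries (Option σ) A} : modEps σ A f = modEps σ A g ↔
    ∀ m : Option σ →₀ ℕ, m none ≤ 1 → MvPowerSeries.coeff m f = MvPowerSeries.coeff m g :=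
  (epsCon σ A).eq

/-- The filtration is not separated: its intersection is the kernel of reduction modulo ε². Filtered
sums are therefore determined precisely up to ε². -/
theorem modEps_eq_iff_mem {f g : MvPowerSeries (Option σ) A} : modEps σ A f = modEps σ A g ↔
    ∀ K, f - g ∈ (epsFiltration K : Submodule ℂ (MvPowerSeries (Option σ) A)) := by
  rw [modEps_eq_iff]
  constructor
  · intro h K m hm _
    rw [map_sub, h m hm, sub_self]
  · intro h m hm
    have := h (m.degree + 1) m hm (Nat.lt_succ_self _)
    rwa [map_sub, sub_eq_zero] at this

theorem IsFilSum.modEps_eq {Y : ℕ → MvPowerSeries (Option σ) A} {s s' : MvPowerSeries (Option σ) A}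
    (h : IsFilSum epsFiltration Y s) (h' : IsFilSum epsFiltration Y s') :
    modEps σ A s = modEps σ A s' :=
  modEps_eq_iff_mem.2 fun K => h.sub_mem h' K

theorem X_none_mem : (MvPowerSeries.X none : MvPowerSeries (Option σ) A) ∈ epsFiltration 1 := by
  classical
  intro m _ h
  have : m.degree = 0 := by omega
  rw [MvPowerSeries.coeff_X, if_neg]
  rintro rfl
  simp at this

omit [Algebra ℂ A] in
theorem coeff_X_none_mul (m : Option σ →₀ ℕ) (f : MvPowerSeries (Option σ) A) :
    MvPowerSeries.coeff m (MvPowerSeries.X none * f) =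
      if m none = 0 then 0 else MvPowerSeries.coeff (m - Finsupp.single none 1) f := by
  classical
  rw [MvPowerSeries.X_def, MvPowerSeries.coeff_monomial_mul]
  have : Finsupp.single none 1 ≤ m ↔ m none ≠ 0 := by
    rw [Finsupp.single_le_iff, Nat.one_le_iff_ne_zero]
  by_cases h : m none = 0 <;> simp [this, h]

omit [Algebra ℂ A] in
theorem modEps_X_none_sq : modEps σ A (MvPowerSeries.X none) * modEps σ A (MvPowerSeries.X none)
    = 0 := by
  rw [← map_mul, ← map_zero (modEps σ A), modEps_eq_iff]
  intro m hm
  rw [coeff_X_none_mul, map_zero]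
  split_ifs with h
  · rfl
  · have h1 := coeff_X_none_mul (m - Finsupp.single none 1) (1 : MvPowerSeries (Option σ) A)
    rw [mul_one] at h1
    rw [h1, if_pos]
    simp
    omega

theorem X_none_mul_mem_of_sq (f : MvPowerSeries (Option σ) A) (K : ℕ) :
    MvPowerSeries.X none * (MvPowerSeries.X none * f) ∈
      (epsFiltration K : Submodule ℂ (MvPowerSeries (Option σ) A)) := by
  have h : modEps σ A (MvPowerSeries.X none * (MvPowerSeries.X none * f)) = modEps σ A 0 := by
    rw [map_mul, map_mul, ← mul_assoc, modEps_X_none_sq, zero_mul, map_zero]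
  simpa using modEps_eq_iff_mem.1 h K

/-- `exp(εx) = 1 + εx` modulo `ε²`. -/
theorem modEps_formalExp_X_none_mul (x : MvPowerSeries (Option σ) A) :
    modEps σ A (formalExp (MvPowerSeries.X none * x)) =
      1 + modEps σ A (MvPowerSeries.X none) * modEps σ A x := by
  have hx : MvPowerSeries.X none * x ∈
      (epsFiltration 1 : Submodule ℂ (MvPowerSeries (Option σ) A)) := by
    have := isRingFiltration_epsFiltration.mul_mem 1 0 _ X_none_mem x
      (by simp [isRingFiltration_epsFiltration.zero])
    simpa using this
  have h : IsFilSum epsFiltration (fun n => (n ! : ℂ)⁻¹ • (MvPowerSeries.X none * x) ^ n)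
      (1 + MvPowerSeries.X none * x) := by
    intro K
    match K with
    | 0 => simp [isRingFiltration_epsFiltration.zero]
    | 1 => simpa using hx
    | K + 2 =>
      rw [Finset.sum_range_succ', Finset.sum_range_succ']
      simp only [zero_add, Nat.factorial_zero, Nat.factorial_one, Nat.cast_one, inv_one, one_smul,
        pow_zero, pow_one]
      rw [add_assoc, add_comm (MvPowerSeries.X none * x) 1, ← sub_sub, sub_right_comm,
        sub_self, zero_sub]
      refine neg_mem (Submodule.sum_mem _ fun k _ => Submodule.smul_mem _ _ ?_)
      have : (MvPowerSeries.X none * x) ^ (k + 1 + 1) = MvPowerSeries.X none *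
          (MvPowerSeries.X none * (x * x * (MvPowerSeries.X none * x) ^ k)) := by
        rw [pow_succ', pow_succ']
        simp only [mul_assoc]
        rw [← mul_assoc x (MvPowerSeries.X none), (MvPowerSeries.commute_X x none).eq, mul_assoc]
      rw [this]
      exact X_none_mul_mem_of_sq _ _
  rw [(isFilSum_formalExp hx).modEps_eq h, map_add, map_one, map_mul]

/-- The expansion of `exp(Z + εV)` modulo `ε²`. -/
theorem modEps_formalExp_add {Z V Φ : MvPowerSeries (Option σ) A}
    (hZ : Z ∈ (epsFiltration 1 : Submodule ℂ (MvPowerSeries (Option σ) A)))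
    (hΦ : IsSeriesApply epsFiltration (negAd Z) expQuotSeries V Φ) :
    modEps σ A (formalExp (Z + MvPowerSeries.X none * V)) = modEps σ A (formalExp Z) *
      (1 + modEps σ A (MvPowerSeries.X none) * modEps σ A Φ) := by
  set e : MvPowerSeries (Option σ) A := MvPowerSeries.X none with he
  have hF := isRingFiltration_epsFiltration (σ := σ) (A := A)
  have hcomm : ∀ x : MvPowerSeries (Option σ) A, x * e = e * x :=
    fun x => (MvPowerSeries.commute_X x none).eq
  have heV : e * V ∈ (epsFiltration 1 : Submodule ℂ (MvPowerSeries (Option σ) A)) := by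
    have := hF.mul_mem 1 0 _ X_none_mem V (by simp [hF.zero])
    simpa using this
  -- Expanding one more factor on the left reproduces the recursion of `powDeriv`, up to a term
  -- containing ε twice.
  have hpow : ∀ n K, (Z + e * V) ^ n - (Z ^ n + e * powDeriv Z V n) ∈
      (epsFiltration K : Submodule ℂ (MvPowerSeries (Option σ) A)) := by
    intro n K
    induction n with
    | zero => simp [powDeriv]
    | succ n ih =>
      have h1 := hF.mul_mem 0 K (Z + e * V) (by simp [hF.zero]) _ ih
      rw [zero_add] at h1
      have h2 := add_mem h1 (X_none_mul_mem_of_sq (V * powDeriv Z V n) K)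
      convert h2 using 1
      rw [powDeriv, pow_succ', pow_succ', ← he]
      simp only [mul_sub, add_mul, mul_add]
      have : e * V * (e * powDeriv Z V n) = e * (e * (V * powDeriv Z V n)) := by
        rw [mul_assoc, ← mul_assoc V, hcomm, mul_assoc]
      have h' : Z * (e * powDeriv Z V n) = e * (Z * powDeriv Z V n) := by
        rw [← mul_assoc, hcomm, mul_assoc]
      rw [this, h', mul_assoc e V, mul_assoc e V (Z ^ n)]
      abel
  have hE := isFilSum_formalExp hZ
  have hprod : IsFilSum epsFiltration (fun n => ((n + 1)! : ℂ)⁻¹ • powDeriv Z V (n + 1))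
      (formalExp Z * Φ) := by
    have := hE.mul hF hΦ fun n => Submodule.smul_mem _ _ (pow_mem_epsFiltration hZ n)
    simp only [expQuotSeries, PowerSeries.coeff_mk] at this
    simpa only [← powDeriv_expTerm] using this
  -- The derivative series starts at n = 1; the lost index is compensated by the factor ε, itself of
  -- order 1.
  have hshift : IsFilSum epsFiltration (fun n => e * ((n ! : ℂ)⁻¹ • powDeriv Z V n))
      (e * (formalExp Z * Φ)) := by
    intro K
    cases K with
    | zero => simp [hF.zero]
    | succ K =>
      have := hF.mul_mem 1 K _ X_none_mem _ (hprod K)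
      rw [Finset.sum_range_succ', powDeriv, smul_zero, mul_zero, add_zero, ← Finset.mul_sum,
        ← mul_sub, add_comm K 1]
      exact this
  have hsum := hE.add hshift
  have hexp := (isFilSum_formalExp (add_mem hZ heV)).congr
    (Y' := fun n => (n ! : ℂ)⁻¹ • Z ^ n + e * ((n ! : ℂ)⁻¹ • powDeriv Z V n)) (by
      intro n K
      rw [mul_smul_comm, ← smul_add, ← smul_sub]
      exact Submodule.smul_mem _ _ (hpow n K))
  rw [hexp.modEps_eq hsum, mul_add, mul_one, map_add, ← map_mul, ← map_mul, ← mul_assoc,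
    ← mul_assoc,
    hcomm]

/-- Moving an element to the right of `exp(Z)`. -/
theorem modEps_mul_formalExp {Z V Φ : MvPowerSeries (Option σ) A}
    (hZ : Z ∈ (epsFiltration 1 : Submodule ℂ (MvPowerSeries (Option σ) A)))
    (hΦ : IsSeriesApply epsFiltration (negAd Z) expSeries V Φ) :
    modEps σ A (V * formalExp Z) = modEps σ A (formalExp Z * Φ) := by
  have hF := isRingFiltration_epsFiltration (σ := σ) (A := A)
  have hE := isFilSum_formalExp hZ
  have h1 := hE.const_mul hF V
  have h2 := hE.mul hF hΦ fun n => Submodule.smul_mem _ _ (pow_mem_epsFiltration hZ n)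
  simp only [expSeries, PowerSeries.coeff_mk, ← mul_expTerm] at h2
  exact h1.modEps_eq h2

/-- e^Z - 1 has order at least 1, so if f - g has order ≥ K then (e^Z - 1)(f - g) has order ≥ K + 1,
and hence so has f - g. No inverse of e^Z is needed. -/
theorem modEps_formalExp_mul_cancel {Z f g : MvPowerSeries (Option σ) A}
    (hZ : Z ∈ (epsFiltration 1 : Submodule ℂ (MvPowerSeries (Option σ) A)))
    (h : modEps σ A (formalExp Z * f) = modEps σ A (formalExp Z * g)) :
    modEps σ A f = modEps σ A g := by
  have hF := isRingFiltration_epsFiltration (σ := σ) (A := A)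
  have hE := isFilSum_formalExp hZ 1
  simp only [Finset.range_one, Finset.sum_singleton, Nat.factorial_zero, Nat.cast_one, inv_one,
    pow_zero, one_smul] at hE
  rw [modEps_eq_iff_mem] at h ⊢
  intro K
  induction K with
  | zero => simp [hF.zero]
  | succ K ih =>
    have h1 := hF.mul_mem _ _ _ hE _ ih
    have h2 := (epsFiltration (K + 1)).sub_mem (h (K + 1)) (by rwa [add_comm 1 K] at h1)
    convert h2 using 1
    rw [sub_mul, one_mul, ← mul_sub]
    abel

end EpsFiltration

/-! ### Power series with values in the Lie algebra -/

section LieSeries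

/-- The `L`-valued power series of order `≥ n`. -/
def lieFiltration (σ L : Type*) [AddCommGroup L] [Module ℂ L] (n : ℕ) :
    Submodule ℂ ((σ →₀ ℕ) → L) where
  carrier := {f | ∀ m, m.degree < n → f m = 0}
  zero_mem' := by intro m _; rfl
  add_mem' := by
    intro x y hx hy m h
    rw [Pi.add_apply, hx m h, hy m h, add_zero]
  smul_mem' := by
    intro r x hx m h
    rw [Pi.smul_apply, hx m h, smul_zero]

theorem lieFiltration_zero (σ L : Type*) [AddCommGroup L] [Module ℂ L] :
    lieFiltration σ L 0 = ⊤ := by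
  ext f
  simp only [Submodule.mem_top, iff_true]
  intro m h
  exact absurd h (Nat.not_lt_zero _)

theorem eq_zero_of_mem_lieFiltration {σ L : Type*} [AddCommGroup L] [Module ℂ L]
    {f : (σ →₀ ℕ) → L} (h : ∀ K, f ∈ lieFiltration σ L K) : f = 0 :=
  funext fun m => h (m.degree + 1) m (Nat.lt_succ_self _)

variable (wt) in
/-- The endomorphism `-ad (∑ z_α J_α)` of the `L`-valued power series. -/
noncomputable def seriesNegAd (J : Module.Basis I ℂ L) : Module.End ℂ ((Pos wt →₀ ℕ) → L) where
  -- Only variables dividing the monomial m contribute, so the sum is finite even when Φ₊ is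
  -- infinite.
  toFun f m := -∑ α ∈ m.support, ⁅J α.1, f (m - Finsupp.single α 1)⁆
  map_add' f g := by
    ext m
    simp [Finset.sum_add_distrib]
    abel
  map_smul' r f := by
    ext m
    simp [Finset.smul_sum]

theorem seriesNegAd_apply (f : (Pos wt →₀ ℕ) → L) (m : Pos wt →₀ ℕ) :
    seriesNegAd wt J f m = -∑ α ∈ m.support, ⁅J α.1, f (m - Finsupp.single α 1)⁆ := rfl

theorem degree_sub_single {σ : Type*} {m : σ →₀ ℕ} {α : σ} (h : α ∈ m.support) :
    (m - Finsupp.single α 1).degree + 1 = m.degree := by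
  have h1 : Finsupp.single α 1 ≤ m := by
    rw [Finsupp.single_le_iff, Nat.one_le_iff_ne_zero]
    simpa using h
  conv_rhs => rw [← tsub_add_cancel_of_le h1, map_add, Finsupp.degree_single]

theorem seriesNegAd_mem (n : ℕ) (f : (Pos wt →₀ ℕ) → L) (hf : f ∈ lieFiltration (Pos wt) L n) :
    seriesNegAd wt J f ∈ lieFiltration (Pos wt) L (n + 1) := by
  intro m hm
  rw [seriesNegAd_apply, neg_eq_zero]
  refine Finset.sum_eq_zero fun α hα => ?_
  have := degree_sub_single hα
  rw [hf _ (by omega), lie_zero]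

/-- The sum of the series `c(X) f`. -/
noncomputable def seriesApply (X : Module.End ℂ ((Pos wt →₀ ℕ) → L)) (c : PowerSeries ℂ)
    (f : (Pos wt →₀ ℕ) → L) : (Pos wt →₀ ℕ) → L :=
  fun m => ∑ n ∈ Finset.range (m.degree + 1), PowerSeries.coeff n c • (X ^ n) f m

theorem isSeriesApply_seriesApply {X : Module.End ℂ ((Pos wt →₀ ℕ) → L)}
    (hX : ∀ n, ∀ f ∈ lieFiltration (Pos wt) L n, X f ∈ lieFiltration (Pos wt) L (n + 1))
    (c : PowerSeries ℂ) (f : (Pos wt →₀ ℕ) → L) :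
    IsSeriesApply (lieFiltration (Pos wt) L) X c f (seriesApply X c f) := by
  intro K m hK
  rw [Pi.sub_apply, Finset.sum_apply, sub_eq_zero]
  refine Finset.sum_subset (Finset.range_mono hK) fun n _ hn => ?_
  have hn' : m.degree < n := by
    rw [Finset.mem_range, not_lt] at hn
    exact hn
  have h : (X ^ n) f ∈ lieFiltration (Pos wt) L (n + 0) :=
    pow_mem_filtration hX n 0 (by simp [lieFiltration_zero])
  rw [h m hn', smul_zero]

/-- The underlying function of `emb`. -/
noncomputable def embFun (f : (Pos wt →₀ ℕ) → L) : FormalGroupRing L wt :=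
  fun m => if m none = 0 then UniversalEnvelopingAlgebra.ι ℂ (f m.some) else 0

theorem coeff_embFun (f : (Pos wt →₀ ℕ) → L) (m : Option (Pos wt) →₀ ℕ) :
    MvPowerSeries.coeff m (embFun f) =
      if m none = 0 then UniversalEnvelopingAlgebra.ι ℂ (f m.some) else 0 := rfl

/-- The inclusion of the `L`-valued power series into the formal group ring. -/
noncomputable def emb (L : Type*) [LieRing L] [LieAlgebra ℂ L] (wt : I → Δ → ℤ) :
    ((Pos wt →₀ ℕ) → L) →ₗ[ℂ] FormalGroupRing L wt where
  toFun := embFun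
  map_add' f g := by
    refine MvPowerSeries.ext fun m => ?_
    simp only [map_add, coeff_embFun, Pi.add_apply]
    split_ifs <;> simp
  map_smul' r f := by
    refine MvPowerSeries.ext fun m => ?_
    change _ = r • MvPowerSeries.coeff m (embFun f)
    simp only [coeff_embFun, Pi.smul_apply]
    split_ifs <;> simp

theorem coeff_emb (f : (Pos wt →₀ ℕ) → L) (m : Option (Pos wt) →₀ ℕ) :
    MvPowerSeries.coeff m (emb L wt f) =
      if m none = 0 then UniversalEnvelopingAlgebra.ι ℂ (f m.some) else 0 := rfl

theorem degree_some {σ : Type*} {m : Option σ →₀ ℕ} (h : m none = 0) :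
    m.some.degree = m.degree := by
  classical
  have h1 : m = m.some.embDomain Function.Embedding.some := by
    ext x
    cases x with
    | none => rw [h, Finsupp.embDomain_of_notMem_range _ _ _ (by simp)]
    | some x =>
      have := Finsupp.embDomain_apply_self Function.Embedding.some m.some x
      exact this.symm
  conv_rhs => rw [h1]
  rw [Finsupp.degree_apply, Finsupp.degree_apply, Finsupp.support_embDomain, Finset.sum_map]
  refine Finset.sum_congr rfl fun x _ => ?_
  exact (Finsupp.embDomain_apply_self Function.Embedding.some m.some x).symm

theorem emb_mem (n : ℕ) (f : (Pos wt →₀ ℕ) → L) (hf : f ∈ lieFiltration (Pos wt) L n) :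
    emb L wt f ∈ (epsFiltration n : Submodule ℂ (FormalGroupRing L wt)) := by
  intro m _ hm
  rw [coeff_emb]
  split_ifs with h
  · rw [hf _ (by rwa [degree_some h]), map_zero]
  · rfl

/-- The generic point `∑ z_α J_α`. -/
noncomputable def genPoint (wt : I → Δ → ℤ) (J : Module.Basis I ℂ L) : FormalGroupRing L wt :=
  genSum J fun α : Pos wt => MvPowerSeries.X α

theorem some_single {σ : Type*} (α : σ) :
    (Finsupp.single (some α) 1 : Option σ →₀ ℕ).some = Finsupp.single α 1 := by
  classical
  ext β
  simp [Finsupp.single_apply]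

theorem coeff_genPoint_single (α : Pos wt) :
    MvPowerSeries.coeff (Finsupp.single (some α) 1) (genPoint wt J) =
      UniversalEnvelopingAlgebra.ι ℂ (J α.1) := by
  classical
  change (if _ then _ else _) = _
  rw [if_pos (by simp), some_single, finsum_eq_single _ α]
  · simp [MvPowerSeries.coeff_X]
  · intro β hβ
    rw [MvPowerSeries.coeff_X, if_neg, zero_smul]
    intro h
    exact hβ (Finsupp.single_left_injective one_ne_zero h).symm

theorem exists_of_coeff_genPoint_ne_zero {m : Option (Pos wt) →₀ ℕ}
    (h : MvPowerSeries.coeff m (genPoint wt J) ≠ 0) : ∃ α, m = Finsupp.single (some α) 1 := by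
  classical
  change (if _ then _ else _) ≠ _ at h
  split_ifs at h with h0
  · obtain ⟨α, hα⟩ := not_forall.1 (mt finsum_eq_zero_of_forall_eq_zero h)
    refine ⟨α, ?_⟩
    rw [MvPowerSeries.coeff_X] at hα
    have h1 : m.some = Finsupp.single α 1 := by
      by_contra h2
      exact hα (by rw [if_neg h2, zero_smul])
    ext x
    cases x with
    | none => simp [h0]
    | some x => rw [← some_single] at h1; exact DFunLike.congr_fun h1 x
  · exact absurd rfl h

theorem coeff_genPoint_mul (m : Option (Pos wt) →₀ ℕ) (g : FormalGroupRing L wt) :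
    MvPowerSeries.coeff m (genPoint wt J * g) = ∑ α ∈ m.some.support,
      UniversalEnvelopingAlgebra.ι ℂ (J α.1) *
        MvPowerSeries.coeff (m - Finsupp.single (some α) 1) g := by
  classical
  rw [MvPowerSeries.coeff_mul]
  symm
  refine Finset.sum_of_injOn
    (fun α => (Finsupp.single (some α) 1, m - Finsupp.single (some α) 1)) ?_ ?_ ?_ ?_
  · intro α _ β _ h
    exact Option.some_injective _ (Finsupp.single_left_injective one_ne_zero (Prod.ext_iff.1 h).1)
  · intro α hα
    rw [Finset.mem_coe, Finset.HasAntidiagonal.mem_antidiagonal]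
    refine add_tsub_cancel_of_le ?_
    rw [Finsupp.single_le_iff, Nat.one_le_iff_ne_zero]
    simpa using hα
  · rintro ⟨p, q⟩ hpq hn
    rw [Finset.HasAntidiagonal.mem_antidiagonal] at hpq
    by_contra h
    obtain ⟨α, rfl⟩ := exists_of_coeff_genPoint_ne_zero (left_ne_zero_of_mul h)
    refine hn ⟨α, ?_, ?_⟩
    · simp [← hpq]
    · simp [← hpq]
  · intro α _
    rw [coeff_genPoint_single]

theorem coeff_mul_genPoint (m : Option (Pos wt) →₀ ℕ) (g : FormalGroupRing L wt) :
    MvPowerSeries.coeff m (g * genPoint wt J) = ∑ α ∈ m.some.support,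
      MvPowerSeries.coeff (m - Finsupp.single (some α) 1) g *
        UniversalEnvelopingAlgebra.ι ℂ (J α.1) := by
  classical
  rw [MvPowerSeries.coeff_mul]
  symm
  refine Finset.sum_of_injOn
    (fun α => (m - Finsupp.single (some α) 1, Finsupp.single (some α) 1)) ?_ ?_ ?_ ?_
  · intro α _ β _ h
    exact Option.some_injective _ (Finsupp.single_left_injective one_ne_zero (Prod.ext_iff.1 h).2)
  · intro α hα
    rw [Finset.mem_coe, Finset.HasAntidiagonal.mem_antidiagonal]
    refine tsub_add_cancel_of_le ?_
    rw [Finsupp.single_le_iff, Nat.one_le_iff_ne_zero]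
    simpa using hα
  · rintro ⟨p, q⟩ hpq hn
    rw [Finset.HasAntidiagonal.mem_antidiagonal] at hpq
    by_contra h
    obtain ⟨α, rfl⟩ := exists_of_coeff_genPoint_ne_zero (right_ne_zero_of_mul h)
    refine hn ⟨α, ?_, ?_⟩
    · simp [← hpq]
    · simp [← hpq]
  · intro α _
    rw [coeff_genPoint_single]

theorem genPoint_mem : genPoint wt J ∈ (epsFiltration 1 : Submodule ℂ (FormalGroupRing L wt)) := by
  intro m _ hm
  by_contra h
  obtain ⟨α, rfl⟩ := exists_of_coeff_genPoint_ne_zero h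
  simp at hm

/-- Commutators in the enveloping algebra are images of brackets, so the series in -ad Z can be
computed with values in the Lie algebra itself. -/
theorem emb_seriesNegAd (f : (Pos wt →₀ ℕ) → L) :
    emb L wt (seriesNegAd wt J f) = negAd (genPoint wt J) (emb L wt f) := by
  ext m
  have hs : ∀ α : Pos wt, (m - Finsupp.single (some α) 1 : Option (Pos wt) →₀ ℕ).some =
      m.some - Finsupp.single α 1 := by
    intro α
    classical
    ext β
    change m (some β) - (Finsupp.single (some α) 1 : Option (Pos wt) →₀ ℕ) (some β) =
      m (some β) - Finsupp.single α 1 β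
    simp [Finsupp.single_apply]
  have hn : ∀ α : Pos wt, (m - Finsupp.single (some α) 1 : Option (Pos wt) →₀ ℕ) none =
      m none := by
    intro α
    simp
  rw [negAd_apply, map_sub, coeff_genPoint_mul, coeff_mul_genPoint, coeff_emb]
  simp only [coeff_emb, hs, hn]
  split_ifs with h
  · rw [seriesNegAd_apply, map_neg, map_sum, ← Finset.sum_sub_distrib, ← Finset.sum_neg_distrib]
    refine Finset.sum_congr rfl fun α _ => ?_
    rw [LieHom.map_lie, LieRing.of_associative_ring_bracket, neg_sub]
  · simp

open Classical in
theorem gen_eq_emb (a : I) : gen wt J a = emb L wt (Pi.single 0 (J a)) := by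
  ext m
  rw [gen, coeff_emb, MvPowerSeries.coeff_C]
  by_cases h : m = 0
  · subst h
    simp
  · rw [if_neg h]
    split_ifs with h0
    · rw [Pi.single_eq_of_ne, map_zero]
      intro h1
      refine h (Finsupp.ext fun x => ?_)
      cases x with
      | none => exact h0
      | some x => exact DFunLike.congr_fun h1 x
    · rfl

/-- The `L`-valued power series `∑ u^α J_α`. -/
noncomputable def lieSum (J : Module.Basis I ℂ L) (u : Pos wt → MvPowerSeries (Pos wt) ℂ) :
    (Pos wt →₀ ℕ) → L :=
  fun m => ∑ᶠ α : Pos wt, MvPowerSeries.coeff m (u α) • J α.1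

/-- The finiteness hypothesis lets the linear map ι pass through the `finsum`, which would default
to 0 on infinite support. -/
theorem genSum_eq_emb {u : Pos wt → MvPowerSeries (Pos wt) ℂ}
    (hu : ∀ m, {α | MvPowerSeries.coeff m (u α) ≠ 0}.Finite) :
    genSum J u = emb L wt (lieSum J u) := by
  ext m
  rw [coeff_emb]
  change (if _ then _ else _) = _
  refine if_congr Iff.rfl ?_ rfl
  let T : L →ₗ[ℂ] UniversalEnvelopingAlgebra ℂ L := UniversalEnvelopingAlgebra.ι (L := L) ℂ
  have h : T (lieSum J u m.some) = _ := map_finsum T (by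
    refine (hu m.some).subset fun α hα h => hα ?_
    change MvPowerSeries.coeff m.some (u α) • J α.1 = 0
    rw [h, zero_smul])
  refine Eq.trans ?_ h.symm
  exact finsum_congr fun α => (T.map_smul _ _).symm

theorem repr_lieSum {u : Pos wt → MvPowerSeries (Pos wt) ℂ}
    (hu : ∀ m, {α | MvPowerSeries.coeff m (u α) ≠ 0}.Finite) (m : Pos wt →₀ ℕ) (α : Pos wt) :
    J.repr (lieSum J u m) α.1 = MvPowerSeries.coeff m (u α) := by
  classical
  have h : J.coord α.1 (lieSum J u m) = _ := map_finsum (J.coord α.1) (by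
    refine (hu m).subset fun α hα h => hα ?_
    simp only [h, zero_smul])
  rw [J.coord_apply] at h
  rw [h, finsum_eq_single _ α]
  · simp
  · intro β hβ
    have : (β : I) ≠ α := fun h => hβ (Subtype.ext h)
    simp [this]

theorem lieSum_mem_posPart {u : Pos wt → MvPowerSeries (Pos wt) ℂ}
    (hu : ∀ m, {α | MvPowerSeries.coeff m (u α) ≠ 0}.Finite) (m : Pos wt →₀ ℕ) :
    posProj wt J (lieSum J u m) = lieSum J u m := by
  classical
  have h : posProj wt J (lieSum J u m) = _ := map_finsum (posProj wt J) (by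
    refine (hu m).subset fun α hα h => hα ?_
    simp only [h, zero_smul])
  rw [h, lieSum]
  refine finsum_congr fun α => ?_
  rw [map_smul, posProj, J.constr_basis, if_pos α.2]

end LieSeries

/-! ### Reduction of the defining equation to a linear one -/

section FieldEquation

open Classical in
/-- The defining equation of the components, with the group elements eliminated. -/
theorem IsRootBasis.isFieldComponents_iff [Fintype Δ] (hJ : IsRootBasis J wt) (a : I)
    {u : Pos wt → MvPowerSeries (Pos wt) ℂ}
    (hu : ∀ m, {α | MvPowerSeries.coeff m (u α) ≠ 0}.Finite) {A Φ : (Pos wt →₀ ℕ) → L}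
    (hA : IsSeriesApply (lieFiltration (Pos wt) L) (seriesNegAd wt J) expSeries
      (Pi.single 0 (J a)) A)
    (hΦ : IsSeriesApply (lieFiltration (Pos wt) L) (seriesNegAd wt J) expQuotSeries
      (lieSum J u) Φ) :
    IsFieldComponents J a u ↔ ∀ m, A m - Φ m ∈ nonposSubmodule wt J := by
  set π := modEps (Pos wt) (UniversalEnvelopingAlgebra ℂ L)
  set ε : FormalGroupRing L wt := MvPowerSeries.X none with hε
  set E := formalExp (genPoint wt J)
  have hZ := genPoint_mem (J := J) (wt := wt)
  have hA' := hA.map (emb L wt) emb_mem emb_seriesNegAd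
  have hΦ' := hΦ.map (emb L wt) emb_mem emb_seriesNegAd
  rw [← gen_eq_emb] at hA'
  rw [← genSum_eq_emb hu] at hΦ'
  have hε2 : π ε * π ε = 0 := modEps_X_none_sq
  have hcomm : ∀ x : FormalGroupRing L wt, π x * π ε = π ε * π x := fun x => by
    rw [← map_mul, ← map_mul, hε, (MvPowerSeries.commute_X x none).eq]
  -- Modulo ε² the two sides are e^Z (1 + εA) and e^Z (1 + εΦ) F. Cancel e^Z and multiply by 1 - εΦ,
  -- the inverse of 1 + εΦ.
  have key : ∀ F : FormalGroupRing L wt,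
      π (formalExp (formalEps L wt * gen wt J a) * E) =
        π (formalExp (genPoint wt J + formalEps L wt * genSum J u) * F) ↔
      π F = π (1 + ε * emb L wt (A - Φ)) := by
    intro F
    have e1 : π (formalExp (formalEps L wt * gen wt J a) * E) =
        π (E * (1 + ε * emb L wt A)) := by
      rw [map_mul, formalEps, modEps_formalExp_X_none_mul, add_mul, one_mul, mul_assoc, ← map_mul,
        modEps_mul_formalExp hZ hA']
      simp only [map_mul, map_add, mul_add, mul_one]
      rw [← mul_assoc, ← hcomm, mul_assoc]
    have e2 : π (formalExp (genPoint wt J + formalEps L wt * genSum J u) * F) =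
        π (E * ((1 + ε * emb L wt Φ) * F)) := by
      rw [map_mul, formalEps, modEps_formalExp_add hZ hΦ']
      simp only [map_mul, map_add, map_one, mul_assoc]
      rfl
    rw [e1, e2]
    have e3 : ∀ x y : FormalGroupRing L wt, π ε * π x * (π ε * π y) = 0 := by
      intro x y
      rw [← mul_assoc, mul_assoc (π ε), hcomm, ← mul_assoc, hε2, zero_mul, zero_mul]
    constructor
    · intro h
      have h1 := modEps_formalExp_mul_cancel hZ h
      have h2 := congrArg (fun x => (1 - π ε * π (emb L wt Φ)) * x) h1
      simp only [map_mul, map_add, map_one] at h2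
      change (1 - π ε * π (emb L wt Φ)) * (1 + π ε * π (emb L wt A)) =
        (1 - π ε * π (emb L wt Φ)) * ((1 + π ε * π (emb L wt Φ)) * π F) at h2
      rw [← mul_assoc] at h2
      simp only [sub_mul, mul_add, add_mul, e3, one_mul, mul_one] at h2
      simp only [map_add, map_mul, map_one, map_sub, mul_sub]
      have e4 : π ε * π (emb L wt Φ) * (π ε * π (emb L wt Φ)) = 0 := e3 _ _
      simp only [zero_mul, sub_zero, sub_add_cancel] at h2
      rw [← h2]
      abel
    · intro h
      rw [map_mul, map_mul π E, map_mul π (1 + _) F, h]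
      congr 1
      simp only [map_add, map_mul, map_one, map_sub, mul_sub, mul_add, add_mul, e3, one_mul,
        mul_one]
      abel
  -- The membership condition on F is read off at the monomials ε z^m.
  have hw : ∀ m : Pos wt →₀ ℕ, MvPowerSeries.coeff (m.embDomain Function.Embedding.some +
      Finsupp.single none 1) (1 + ε * emb L wt (A - Φ)) =
        UniversalEnvelopingAlgebra.ι ℂ (A m - Φ m) := by
    intro m
    have h0 : (m.embDomain Function.Embedding.some : Option (Pos wt) →₀ ℕ) none = 0 :=
      Finsupp.embDomain_of_notMem_range _ _ _ (by simp)
    have hs : (m.embDomain Function.Embedding.some : Option (Pos wt) →₀ ℕ).some = m := by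
      ext x
      exact Finsupp.embDomain_apply_self Function.Embedding.some m x
    rw [map_add, coeff_X_none_mul, if_neg (by simp), add_tsub_cancel_right, coeff_emb, if_pos h0,
      hs, MvPowerSeries.coeff_one, if_neg, zero_add]
    · rfl
    · intro h
      have := DFunLike.congr_fun h none
      simp at this
  constructor
  · rintro ⟨-, F, hF, h⟩ m
    have h1 := (key F).1 (modEps_eq_iff.2 h)
    have h2 := modEps_eq_iff.1 h1 (m.embDomain Function.Embedding.some + Finsupp.single none 1) (by
      have h0 : (m.embDomain Function.Embedding.some : Option (Pos wt) →₀ ℕ) none = 0 :=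
        Finsupp.embDomain_of_notMem_range _ _ _ (by simp)
      simp [h0])
    rw [← hJ.ι_mem_nonposSubalgebra_iff, ← hw, ← h2]
    exact hF _
  · intro h
    refine ⟨hu, 1 + ε * emb L wt (A - Φ), fun m => ?_, modEps_eq_iff.1 ((key _).2 rfl)⟩
    rw [map_add]
    refine add_mem ?_ ?_
    · rw [MvPowerSeries.coeff_one]
      split_ifs
      · exact one_mem _
      · exact zero_mem _
    · rw [coeff_X_none_mul]
      split_ifs
      · exact zero_mem _
      · rw [coeff_emb]
        split_ifs
        · exact (hJ.ι_mem_nonposSubalgebra_iff _).2 (h _)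
        · exact zero_mem _

end FieldEquation

/-! ### Coefficient functions on words and the origin of β -/

section Words

/-- Functions on words vanishing on the words of length `< n`. -/
def wordFiltration (σ : Type*) (n : ℕ) : Submodule ℂ (List σ → ℂ) where
  carrier := {w | ∀ l, l.length < n → w l = 0}
  zero_mem' := by intro m _; rfl
  add_mem' := by
    intro x y hx hy m h
    rw [Pi.add_apply, hx m h, hy m h, add_zero]
  smul_mem' := by
    intro r x hx m h
    rw [Pi.smul_apply, hx m h, smul_zero]

/-- The operator `(X w)(l ++ [b]) = -w(l)` on functions on words. -/
def wordShift (σ : Type*) : Module.End ℂ (List σ → ℂ) where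
  toFun w l := if l = [] then 0 else -w l.dropLast
  map_add' v w := by
    ext l
    by_cases h : l = []
    · simp [h]
    · simp [h, add_comm]
  map_smul' r w := by
    ext l
    by_cases h : l = [] <;> simp [h]

theorem wordShift_nil {σ : Type*} (w : List σ → ℂ) : wordShift σ w [] = 0 := rfl

theorem wordShift_concat {σ : Type*} (w : List σ → ℂ) (l : List σ) (b : σ) :
    wordShift σ w (l ++ [b]) = -w l := by
  simp [wordShift]

theorem wordShift_pow_apply {σ : Type*} (w : List σ → ℂ) (j : ℕ) (l : List σ) :
    (wordShift σ ^ j) w l =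
      if j ≤ l.length then (-1) ^ j * w (l.take (l.length - j)) else 0 := by
  induction j generalizing l with
  | zero => simp
  | succ j ih =>
    rw [pow_succ', Module.End.mul_apply]
    induction l using List.reverseRecOn with
    | nil => simp [wordShift_nil]
    | append_singleton l b _ =>
      rw [wordShift_concat, ih, List.length_append, List.length_singleton, Nat.add_sub_add_right,
        List.take_append_of_le_length (Nat.sub_le _ _)]
      simp only [add_le_add_iff_right]
      split_ifs
      · ring
      · simp

/-- The word function `(-1)ᵏ / k!`. -/
noncomputable def expWord (σ : Type*) (l : List σ) : ℂ :=
  (-1) ^ l.length * (l.length ! : ℂ)⁻¹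

variable (wt) in
open Classical in
/-- The word function `(-1)ᵏ / k!`, restricted to the words of positive total weight. -/
noncomputable def posExpWord (a : I) (l : List (Pos wt)) : ℂ :=
  if 0 < totalWeight wt a l then expWord _ l else 0

variable (wt) in
/-- The coefficients `-β_{k,λ}` as a word function. -/
noncomputable def fieldWord (a : I) (l : List (Pos wt)) : ℂ :=
  ∑ j ∈ Finset.range (l.length + 1),
    PowerSeries.coeff j todd * ((-1) ^ j * posExpWord wt a (l.take (l.length - j)))

theorem isSeriesApply_expWord (σ : Type*) [DecidableEq (List σ)] :
    IsSeriesApply (wordFiltration σ) (wordShift σ) expSeries (Pi.single [] 1) (expWord σ) := by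
  intro K l hl
  rw [Pi.sub_apply, Finset.sum_apply, sub_eq_zero, Finset.sum_eq_single_of_mem l.length]
  · rw [Pi.smul_apply, wordShift_pow_apply, if_pos le_rfl]
    rw [Nat.sub_self, List.take_zero, Pi.single_eq_same, mul_one, smul_eq_mul, mul_comm]
    simp [expWord, expSeries]
  · simpa using hl
  · intro n _ hn
    rw [Pi.smul_apply, wordShift_pow_apply]
    split_ifs with h
    · rw [Pi.single_eq_of_ne, mul_zero, smul_zero]
      intro h0
      have := congrArg List.length h0
      rw [List.length_take, List.length_nil] at this
      omega
    · simp

theorem isSeriesApply_fieldWord (a : I) :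
    IsSeriesApply (wordFiltration (Pos wt)) (wordShift (Pos wt)) todd (posExpWord wt a)
      (fieldWord wt a) := by
  intro K l hl
  rw [Pi.sub_apply, Finset.sum_apply, sub_eq_zero, fieldWord]
  have h1 : ∀ j ∈ Finset.range (l.length + 1),
      PowerSeries.coeff j todd * ((-1) ^ j * posExpWord wt a (l.take (l.length - j))) =
      (PowerSeries.coeff j todd • (wordShift (Pos wt) ^ j) (posExpWord wt a)) l := by
    intro j hj
    rw [Pi.smul_apply, wordShift_pow_apply, if_pos (Nat.lt_succ_iff.1 (Finset.mem_range.1 hj)),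
      smul_eq_mul]
  rw [Finset.sum_congr rfl h1]
  refine Finset.sum_subset (Finset.range_mono hl) fun n _ hn => ?_
  rw [Pi.smul_apply, wordShift_pow_apply, if_neg, smul_zero]
  intro h
  exact hn (Finset.mem_range.2 (Nat.lt_succ_of_le h))

/-- If the whole word is not of positive weight, no prefix is. -/
theorem fieldWord_eq_zero {a : I} {l : List (Pos wt)} (h : ¬ 0 < totalWeight wt a l) :
    fieldWord wt a l = 0 := by
  refine Finset.sum_eq_zero fun j _ => ?_
  rw [posExpWord, if_neg, mul_zero, mul_zero]
  intro h'
  refine h (h'.trans_le ?_)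
  have := totalWeight_take_mono a l (Nat.sub_le l.length j)
  rwa [List.take_length] at this

/-- The prefix of length k - j is positive iff j ≤ k - λ, which truncates the sum. The signs (-1)^j
and (-1)^{k-j} combine to (-1)^k, opposite to the sign in β. -/
theorem fieldWord_eq {a : I} {α : Pos wt} {l : List (Pos wt)} (hl : l ∈ tuples wt a α) :
    fieldWord wt a l = -(beta l.length (crossing wt a l) : ℂ) := by
  have hle := (isLeast_crossing hl).2
  rw [fieldWord, beta]
  push_cast
  rw [pow_succ, mul_neg_one, neg_mul, neg_neg, Finset.mul_sum]
  symm
  refine Finset.sum_subset_zero_on_sdiff (Finset.range_mono (by omega)) ?_ ?_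
  · intro j hj
    rw [Finset.mem_sdiff, Finset.mem_range, Finset.mem_range] at hj
    rw [posExpWord, if_neg, mul_zero, mul_zero]
    rw [take_pos_iff hl]
    omega
  · intro j hj
    rw [Finset.mem_range] at hj
    rw [posExpWord, if_pos ((take_pos_iff hl _).2 (by omega)), expWord, List.length_take,
      min_eq_left (Nat.sub_le _ _), coeff_todd]
    have : (-1 : ℂ) ^ l.length = (-1) ^ j * (-1) ^ (l.length - j) := by
      rw [← pow_add, Nat.add_sub_cancel' (by omega)]
    rw [this, div_eq_mul_inv, mul_inv]
    ring

/-- The nested bracket is homogeneous, so its α-coordinate vanishes unless the word has total weight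
α; a sum over all words collapses to one over `tuples`. -/
theorem IsRootBasis.repr_fieldWord_smul (hJ : IsRootBasis J wt) (a : I) (l : List (Pos wt))
    (α : Pos wt) [Decidable (l ∈ tuples wt a α)] :
    fieldWord wt a l * J.repr (chain J (J a) l) α.1 = if l ∈ tuples wt a α then
      -((beta l.length (crossing wt a l) : ℂ) * coeffC J a l α.1) else 0 := by
  split_ifs with h
  · rw [fieldWord_eq h, coeffC_eq, neg_mul]
  · by_cases h' : J.repr (chain J (J a) l) α.1 = 0
    · rw [h', mul_zero]
    · exact absurd (hJ.chain_mem_weightSpace a l _ h').symm h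

end Words

/-! ### The closed formula in the formal group -/

section Formal

open Classical in
/-- The words with given multiplicities. -/
noncomputable def orderings {σ : Type*} (m : σ →₀ ℕ) : Finset (List σ) :=
  (Finsupp.toMultiset m).lists.toFinset

theorem mem_orderings {σ : Type*} {m : σ →₀ ℕ} {l : List σ} :
    l ∈ orderings m ↔ Finsupp.toMultiset m = (l : Multiset σ) := by
  classical
  rw [orderings, Multiset.mem_toFinset, Multiset.mem_lists_iff]
  rfl

theorem length_of_mem_orderings {σ : Type*} {m : σ →₀ ℕ} {l : List σ} (h : l ∈ orderings m) :
    l.length = m.degree := by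
  rw [mem_orderings] at h
  rw [← Multiset.coe_card, ← h, Finsupp.card_toMultiset]
  rfl

/-- The `L`-valued power series `∑ w(l) z_l [J_{l_k}, …, [J_{l_1}, x]]`. -/
noncomputable def chainSeries (J : Module.Basis I ℂ L) (x : L) :
    (List (Pos wt) → ℂ) →ₗ[ℂ] ((Pos wt →₀ ℕ) → L) where
  toFun w m := ∑ l ∈ orderings m, w l • chain J x l
  map_add' v w := by
    ext m
    simp [add_smul, Finset.sum_add_distrib]
  map_smul' r w := by
    ext m
    simp [mul_smul, Finset.smul_sum]

theorem chainSeries_apply (x : L) (w : List (Pos wt) → ℂ) (m : Pos wt →₀ ℕ) :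
    chainSeries J x w m = ∑ l ∈ orderings m, w l • chain J x l := rfl

theorem chainSeries_mem (x : L) (n : ℕ) (w : List (Pos wt) → ℂ)
    (hw : w ∈ wordFiltration (Pos wt) n) : chainSeries J x w ∈ lieFiltration (Pos wt) L n := by
  intro m hm
  refine Finset.sum_eq_zero fun l hl => ?_
  rw [hw l (by rwa [length_of_mem_orderings hl]), zero_smul]

theorem toMultiset_eq_sub_single {σ : Type*} {m : σ →₀ ℕ} {α : σ} (h : α ∈ m.support) :
    Finsupp.toMultiset m = Finsupp.toMultiset (m - Finsupp.single α 1) + {α} := by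
  have h1 : Finsupp.single α 1 ≤ m := by
    rw [Finsupp.single_le_iff, Nat.one_le_iff_ne_zero]
    simpa using h
  conv_lhs => rw [← tsub_add_cancel_of_le h1, map_add, Finsupp.toMultiset_single, one_smul]

/-- Removing the last letter α matches the words with content m ending in α with the words with
content m - α. -/
theorem chainSeries_wordShift (x : L) (w : List (Pos wt) → ℂ) :
    chainSeries J x (wordShift _ w) = seriesNegAd wt J (chainSeries J x w) := by
  ext m
  rw [seriesNegAd_apply, chainSeries_apply, ← Finset.sum_neg_distrib]
  simp only [chainSeries_apply, lie_sum, ← Finset.sum_neg_distrib]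
  rw [Finset.sum_sigma']
  symm
  refine Finset.sum_of_injOn (fun p => p.2 ++ [p.1]) ?_ ?_ ?_ ?_
  · rintro ⟨α, l⟩ _ ⟨β, l'⟩ _ h
    obtain ⟨rfl, h2⟩ := List.append_inj' h rfl
    obtain rfl : α = β := by simpa using h2
    rfl
  · rintro ⟨α, l⟩ h
    simp only [Finset.mem_coe, Finset.mem_sigma] at h
    rw [Finset.mem_coe, mem_orderings, toMultiset_eq_sub_single h.1, mem_orderings.1 h.2]
    rfl
  · intro l hl hn
    induction l using List.reverseRecOn with
    | nil => rw [wordShift_nil, zero_smul]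
    | append_singleton l α _ =>
      have hα : α ∈ m.support := by
        rw [← Finsupp.mem_toMultiset, mem_orderings.1 hl]
        simp
      refine absurd ⟨⟨α, l⟩, ?_, rfl⟩ hn
      simp only [Finset.mem_coe, Finset.mem_sigma]
      refine ⟨hα, ?_⟩
      rw [mem_orderings] at hl ⊢
      rw [toMultiset_eq_sub_single hα, ← Multiset.coe_add] at hl
      exact add_right_cancel hl
  · rintro ⟨α, l⟩ _
    rw [wordShift_concat, chain_concat, lie_smul, neg_smul]

theorem chainSeries_single [DecidableEq (List (Pos wt))] [DecidableEq (Pos wt →₀ ℕ)] (x : L) :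
    chainSeries (wt := wt) J x (Pi.single [] 1) = Pi.single 0 x := by
  ext m
  rw [chainSeries_apply]
  by_cases hm : m = 0
  · subst hm
    rw [Pi.single_eq_same, Finset.sum_eq_single_of_mem []]
    · simp [chain]
    · rw [mem_orderings]; simp
    · intro l _ hl
      rw [Pi.single_eq_of_ne hl, zero_smul]
  · rw [Pi.single_eq_of_ne hm]
    refine Finset.sum_eq_zero fun l hl => ?_
    rw [Pi.single_eq_of_ne, zero_smul]
    rintro rfl
    refine hm ?_
    have := length_of_mem_orderings hl
    rw [List.length_nil, eq_comm, Finsupp.degree_eq_zero_iff] at this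
    exact this

/-- By homogeneity the projection keeps or kills the whole bracket, so it can be absorbed into the
word function. -/
theorem IsRootBasis.posProj_chain (hJ : IsRootBasis J wt) (a : I) (l : List (Pos wt)) :
    expWord _ l • posProj wt J (chain J (J a) l) = posExpWord wt a l • chain J (J a) l := by
  rw [posProj_of_mem_weightSpace (hJ.chain_mem_weightSpace a l), posExpWord]
  split_ifs <;> simp

theorem IsRootBasis.posProj_fieldWord (hJ : IsRootBasis J wt) (a : I) (l : List (Pos wt)) :
    fieldWord wt a l • posProj wt J (chain J (J a) l) = fieldWord wt a l • chain J (J a) l := by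
  rw [posProj_of_mem_weightSpace (hJ.chain_mem_weightSpace a l)]
  split_ifs with h
  · rfl
  · rw [fieldWord_eq_zero h]; simp

theorem IsRootBasis.posProj_lie (hJ : IsRootBasis J wt) (b : Pos wt) {x : L}
    (hx : posProj wt J x = x) : posProj wt J ⁅J b.1, x⁆ = ⁅J b.1, x⁆ := by
  rw [← hx]
  have : posProj wt J ∘ₗ (LieModule.toEnd ℂ L L (J b.1)) ∘ₗ posProj wt J =
      (LieModule.toEnd ℂ L L (J b.1)) ∘ₗ posProj wt J := by
    classical
    refine J.ext fun c => ?_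
    simp only [LinearMap.comp_apply, LieModule.toEnd_apply_apply]
    have hc : posProj wt J (J c) = if 0 < wt c then J c else 0 := by
      rw [posProj, J.constr_basis]
    rw [hc]
    split_ifs with h
    · rw [posProj_of_mem_weightSpace
        (hJ.lie_mem_weightSpace b.1 (basis_mem_weightSpace (J := J) c)),
        if_pos (add_pos b.2 h)]
    · simp
  exact LinearMap.congr_fun this x

theorem prod_map_X {σ : Type*} [DecidableEq σ] (l : List σ) :
    (l.map (MvPolynomial.X : σ → MvPolynomial σ ℂ)).prod =
      MvPolynomial.monomial (Multiset.toFinsupp (l : Multiset σ)) 1 := by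
  induction l with
  | nil => simp
  | cons b l ih =>
    rw [List.map_cons, List.prod_cons, ih, MvPolynomial.X, MvPolynomial.monomial_mul, one_mul,
      ← Multiset.cons_coe, ← Multiset.singleton_add, map_add, Multiset.toFinsupp_singleton]

open Classical in
theorem coeff_term (a : I) (l : List (Pos wt)) (α : Pos wt) (m : Pos wt →₀ ℕ) :
    MvPolynomial.coeff m (term J a l α) = if l ∈ orderings m then
      (beta l.length (crossing wt a l) : ℂ) * coeffC J a l α.1 else 0 := by
  rw [term, MvPolynomial.coeff_C_mul, prod_map_X, MvPolynomial.coeff_monomial]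
  have : Multiset.toFinsupp (l : Multiset (Pos wt)) = m ↔ Finsupp.toMultiset m = l := by
    rw [Multiset.toFinsupp_eq_iff, eq_comm]
  by_cases h : Finsupp.toMultiset m = l
  · rw [if_pos (this.2 h), if_pos (mem_orderings.2 h), mul_one]
  · rw [if_neg (mt this.1 h), if_neg (mt mem_orderings.1 h), mul_zero]

theorem IsRootBasis.coeff_formula [Finite Δ] (hJ : IsRootBasis J wt) (a : I) (α : Pos wt)
    (m : Pos wt →₀ ℕ) : MvPolynomial.coeff m (formula wt J a α) =
      J.repr (chainSeries J (J a) (fieldWord wt a) m) α.1 := by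
  classical
  rw [formula, finsum_mem_eq_finite_toFinset_sum _ (hJ.finite_tuples a α), MvPolynomial.coeff_neg,
    MvPolynomial.coeff_sum, chainSeries_apply, map_sum, Finsupp.finsetSum_apply]
  simp only [map_smul, Finsupp.smul_apply, smul_eq_mul, hJ.repr_fieldWord_smul, coeff_term]
  rw [← Finset.sum_filter, ← Finset.sum_filter, Finset.sum_neg_distrib]
  congr 2
  ext l
  simp [and_comm]

/-- For a fixed monomial these coefficients are coordinates of a single vector of the Lie algebra.
-/
theorem IsRootBasis.finite_coeff_formula [Finite Δ] (hJ : IsRootBasis J wt) (a : I)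
    (m : Pos wt →₀ ℕ) : {α | MvPolynomial.coeff m (formula wt J a α) ≠ 0}.Finite := by
  simp only [hJ.coeff_formula]
  refine Set.Finite.subset (Set.Finite.preimage (f := Subtype.val)
    Subtype.val_injective.injOn
    (J.repr (chainSeries J (J a) (fieldWord wt a) m)).hasFiniteSupport) ?_
  intro α hα
  exact hα

/-- Projecting the linear equation to the positive part gives φ(X)V = P e^X J_a, and multiplying by
φ(X)⁻¹ yields the image of `fieldWord`, whose coordinates are the closed formula. -/
theorem IsRootBasis.isFieldComponents_iff_formula [Finite Δ] (hJ : IsRootBasis J wt) (a : I)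
    (u : Pos wt → MvPowerSeries (Pos wt) ℂ) :
    IsFieldComponents J a u ↔ ∀ α, u α = (formula wt J a α : MvPolynomial (Pos wt) ℂ) := by
  classical
  cases nonempty_fintype Δ
  have key : (∀ m, {α | MvPowerSeries.coeff m (u α) ≠ 0}.Finite) →
      (IsFieldComponents J a u ↔
        ∀ α, u α = (formula wt J a α : MvPolynomial (Pos wt) ℂ)) := by
    intro hu
    set X := seriesNegAd wt J
    set T := chainSeries (wt := wt) J (J a)
    have hA : IsSeriesApply (lieFiltration (Pos wt) L) X expSeries (Pi.single 0 (J a))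
        (T (expWord _)) := by
      rw [← chainSeries_single]
      exact (isSeriesApply_expWord _).map T (chainSeries_mem _) (chainSeries_wordShift _)
    have hU : IsSeriesApply (lieFiltration (Pos wt) L) X todd (T (posExpWord wt a))
        (T (fieldWord wt a)) :=
      (isSeriesApply_fieldWord a).map T (chainSeries_mem _) (chainSeries_wordShift _)
    have hΦ := isSeriesApply_seriesApply (X := X) seriesNegAd_mem expQuotSeries (lieSum J u)
    -- Z and V have only positive components, so the iterated brackets do too and P acts trivially
    -- on φ(X)V.
    have hpow : ∀ n m, posProj wt J ((X ^ n) (lieSum J u) m) = (X ^ n) (lieSum J u) m := by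
      intro n
      induction n with
      | zero => exact lieSum_mem_posPart hu
      | succ n ih =>
        intro m
        rw [pow_succ', Module.End.mul_apply, seriesNegAd_apply, map_neg, map_sum]
        exact congrArg _ (Finset.sum_congr rfl fun α _ => hJ.posProj_lie α (ih _))
    have hPΦ : ∀ m, posProj wt J (seriesApply X expQuotSeries (lieSum J u) m) =
        seriesApply X expQuotSeries (lieSum J u) m := by
      intro m
      simp only [seriesApply, map_sum, map_smul, hpow]
    have hPA : ∀ m, posProj wt J (T (expWord _) m) = T (posExpWord wt a) m := by
      intro m
      simp only [T, chainSeries_apply, map_sum, map_smul, hJ.posProj_chain]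
    have hPU : ∀ m, posProj wt J (T (fieldWord wt a) m) = T (fieldWord wt a) m := by
      intro m
      simp only [T, chainSeries_apply, map_sum, map_smul, hJ.posProj_fieldWord]
    rw [hJ.isFieldComponents_iff a hu hA hΦ]
    have h1 : (∀ m, T (expWord _) m - seriesApply X expQuotSeries (lieSum J u) m ∈
        nonposSubmodule wt J) ↔
        seriesApply X expQuotSeries (lieSum J u) = T (posExpWord wt a) := by
      rw [funext_iff]
      refine forall_congr' fun m => ?_
      rw [nonposSubmodule, LinearMap.mem_ker, map_sub, hPΦ, hPA, sub_eq_zero, eq_comm]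
    rw [h1, IsSeriesApply.eq_iff seriesNegAd_mem (lieFiltration_zero _ _)
      (fun _ => eq_zero_of_mem_lieFiltration) todd_mul_expQuotSeries hΦ hU]
    have h2 : ∀ α m, MvPowerSeries.coeff m (u α) = J.repr (lieSum J u m) α.1 :=
      fun α m => (repr_lieSum hu m α).symm
    constructor
    · intro h α
      ext m
      rw [MvPolynomial.coeff_coe, hJ.coeff_formula, h2, h]
    · intro h
      funext m
      refine J.repr.injective (Finsupp.ext fun c => ?_)
      by_cases hc : 0 < wt c
      · rw [← h2 ⟨c, hc⟩, h, MvPolynomial.coeff_coe, hJ.coeff_formula]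
      · rw [← lieSum_mem_posPart hu, ← hPU, repr_posProj, repr_posProj, if_neg hc, if_neg hc]
  constructor
  · intro h
    exact (key h.1).1 h
  · intro h
    -- The finiteness condition on the family is not assumed in this direction; the formula itself
    -- supplies it.
    refine (key fun m => ?_).2 h
    simp only [h, MvPolynomial.coeff_coe]
    exact hJ.finite_coeff_formula a m

/-- The formula for the vector field on polynomials. -/
theorem IsRootBasis.vectorField_eq [Finite Δ] (hJ : IsRootBasis J wt) (a : I)
    {u : Pos wt → MvPowerSeries (Pos wt) ℂ}
    (hu : ∀ α, u α = (formula wt J a α : MvPolynomial (Pos wt) ℂ))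
    (p : MvPolynomial (Pos wt) ℂ) :
    {q : List (Pos wt) × Pos wt | q.1 ∈ tuples wt a q.2 ∧
      term J a q.1 q.2 * MvPolynomial.pderiv q.2 p ≠ 0}.Finite ∧
    vectorField u p =
      ((∑ᶠ q ∈ {q : List (Pos wt) × Pos wt | q.1 ∈ tuples wt a q.2},
        term J a q.1 q.2 * MvPolynomial.pderiv q.2 p : MvPolynomial (Pos wt) ℂ) :
        MvPowerSeries (Pos wt) ℂ) := by
  classical
  -- ∂/∂z_α kills p unless z_α occurs in p, so finitely many α remain, each with finitely many
  -- tuples.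
  set S : Finset (List (Pos wt) × Pos wt) :=
    p.vars.biUnion fun α => (hJ.finite_tuples a α).toFinset.image fun l => (l, α) with hS
  have hmem : ∀ q, q ∈ S ↔ q.2 ∈ p.vars ∧ q.1 ∈ tuples wt a q.2 := by
    rintro ⟨l, α⟩
    simp only [hS, Finset.mem_biUnion, Finset.mem_image, Set.Finite.mem_toFinset, Prod.mk.injEq]
    constructor
    · rintro ⟨β, hβ, l', hl', rfl, rfl⟩
      exact ⟨hβ, hl'⟩
    · rintro ⟨h1, h2⟩
      exact ⟨α, h1, l, h2, rfl, rfl⟩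
  have hsub : {q : List (Pos wt) × Pos wt | q.1 ∈ tuples wt a q.2 ∧
      term J a q.1 q.2 * MvPolynomial.pderiv q.2 p ≠ 0} ⊆ S := by
    rintro q ⟨h1, h2⟩
    refine (hmem q).2 ⟨?_, h1⟩
    by_contra h
    exact h2 (by rw [MvPolynomial.pderiv_eq_zero_of_notMem_vars h, mul_zero])
  refine ⟨S.finite_toSet.subset hsub, ?_⟩
  have hsum : ∑ᶠ q ∈ {q : List (Pos wt) × Pos wt | q.1 ∈ tuples wt a q.2},
      term J a q.1 q.2 * MvPolynomial.pderiv q.2 p =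
      -∑ α ∈ p.vars, formula wt J a α * MvPolynomial.pderiv α p := by
    rw [finsum_mem_eq_sum_of_inter_support_eq (t := S), hS, Finset.sum_biUnion,
      ← Finset.sum_neg_distrib]
    · refine Finset.sum_congr rfl fun α _ => ?_
      rw [Finset.sum_image (fun _ _ _ _ h => (Prod.ext_iff.1 h).1), formula,
        finsum_mem_eq_finite_toFinset_sum _ (hJ.finite_tuples a α), neg_mul, neg_neg,
        Finset.sum_mul]
    · intro α _ β _ hαβ
      rw [Function.onFun, Finset.disjoint_left]
      rintro q h1 h2
      obtain ⟨l, -, rfl⟩ := Finset.mem_image.1 h1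
      obtain ⟨l', -, h3⟩ := Finset.mem_image.1 h2
      exact hαβ (Prod.ext_iff.1 h3).2.symm
    · ext q
      constructor
      · rintro ⟨h1, h2⟩
        exact ⟨hsub ⟨h1, h2⟩, h2⟩
      · rintro ⟨h1, h2⟩
        exact ⟨((hmem q).1 h1).2, h2⟩
  rw [hsum, vectorField]
  simp only [hu]
  have hc : ∀ q : MvPolynomial (Pos wt) ℂ, (q : MvPowerSeries (Pos wt) ℂ) =
      MvPolynomial.coeToMvPowerSeries.ringHom q := fun _ => rfl
  simp only [hc, map_neg, map_sum, map_mul]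

end Formal

/-! ### First-order expansion of exponentials in a Banach algebra -/

section Banach

open Asymptotics NormedSpace

variable {B : Type*} [NormedRing B] [NormedAlgebra ℂ B]

-- The norm of 1 is not assumed to be 1; hence the factor ‖1‖, which persists in the later bounds.
omit [NormedAlgebra ℂ B] in
theorem norm_pow_le_one_norm_mul (Z : B) {M : ℝ} (hZ : ‖Z‖ ≤ M) (n : ℕ) :
    ‖Z ^ n‖ ≤ ‖(1 : B)‖ * M ^ n := by
  induction n with
  | zero => simp
  | succ n ih =>
    rw [pow_succ, pow_succ, ← mul_assoc]
    exact (norm_mul_le _ _).trans (mul_le_mul ih hZ (norm_nonneg _) ((norm_nonneg _).trans ih))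

omit [NormedAlgebra ℂ B] in
theorem norm_powDeriv_le (Z V : B) (n : ℕ) :
    ‖powDeriv Z V n‖ ≤ ‖(1 : B)‖ * (n * (‖Z‖ + ‖V‖) ^ n) := by
  set M := ‖Z‖ + ‖V‖
  have hZ : ‖Z‖ ≤ M := le_add_of_nonneg_right (norm_nonneg _)
  have hV : ‖V‖ ≤ M := le_add_of_nonneg_left (norm_nonneg _)
  have hM : 0 ≤ M := (norm_nonneg _).trans hZ
  induction n with
  | zero => simp [powDeriv]
  | succ n ih =>
    have h1 : ‖Z * powDeriv Z V n‖ ≤ M * (‖(1 : B)‖ * (n * M ^ n)) :=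
      (norm_mul_le _ _).trans (mul_le_mul hZ ih (norm_nonneg _) hM)
    have h2 : ‖V * Z ^ n‖ ≤ M * (‖(1 : B)‖ * M ^ n) :=
      (norm_mul_le _ _).trans
        (mul_le_mul hV (norm_pow_le_one_norm_mul Z hZ n) (norm_nonneg _) hM)
    refine (norm_add_le _ _).trans ((add_le_add h1 h2).trans (le_of_eq ?_))
    push_cast
    ring

/-- The remainders satisfy R_{n+1} = (Z + εV) R_n + ε² V · `powDeriv Z V n`; since n² + n ≤ (n+1)²,
the quadratic factor suffices. -/
theorem norm_pow_add_sub_le (Z V : B) {ε : ℂ} (hε : ‖ε‖ ≤ 1) (n : ℕ) :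
    ‖(Z + ε • V) ^ n - Z ^ n - ε • powDeriv Z V n‖ ≤
      ‖ε‖ ^ 2 * (‖(1 : B)‖ * ((n : ℝ) ^ 2 * (‖Z‖ + ‖V‖) ^ n)) := by
  set M := ‖Z‖ + ‖V‖
  have hV : ‖V‖ ≤ M := le_add_of_nonneg_left (norm_nonneg _)
  have hM : 0 ≤ M := (norm_nonneg _).trans hV
  induction n with
  | zero => simp [powDeriv]
  | succ n ih =>
    have e : (Z + ε • V) ^ (n + 1) - Z ^ (n + 1) - ε • powDeriv Z V (n + 1) =
        (Z + ε • V) * ((Z + ε • V) ^ n - Z ^ n - ε • powDeriv Z V n) +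
          ε ^ 2 • (V * powDeriv Z V n) := by
      rw [powDeriv, pow_succ', pow_succ']
      simp only [mul_sub, add_mul, smul_add, mul_smul_comm, smul_mul_assoc, smul_smul, sq]
      abel
    have h0 : ‖Z + ε • V‖ ≤ M := by
      refine (norm_add_le _ _).trans (add_le_add le_rfl ?_)
      rw [norm_smul]
      exact mul_le_of_le_one_left (norm_nonneg _) hε
    have h1 := (norm_mul_le (Z + ε • V) ((Z + ε • V) ^ n - Z ^ n - ε • powDeriv Z V n)).trans
      (mul_le_mul h0 ih (norm_nonneg _) hM)
    have h2 : ‖ε ^ 2 • (V * powDeriv Z V n)‖ ≤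
        ‖ε‖ ^ 2 * (M * (‖(1 : B)‖ * (n * M ^ n))) := by
      rw [norm_smul, norm_pow]
      exact mul_le_mul_of_nonneg_left ((norm_mul_le _ _).trans
        (mul_le_mul hV (norm_powDeriv_le Z V n) (norm_nonneg _) hM)) (by positivity)
    rw [e]
    refine (norm_add_le _ _).trans ((add_le_add h1 h2).trans ?_)
    have h3 : 0 ≤ ‖ε‖ ^ 2 * (‖(1 : B)‖ * (((n : ℝ) + 1) * M ^ (n + 1))) := by positivity
    push_cast
    have h4 : M ^ (n + 1) = M * M ^ n := pow_succ' M n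
    rw [h4] at h3 ⊢
    linarith

theorem exp_eq_tsum_complex (Z : B) : exp Z = ∑' n : ℕ, (n ! : ℂ)⁻¹ • Z ^ n :=
  congrFun (exp_eq_tsum ℂ) Z

variable [CompleteSpace B]

theorem summable_powDeriv (Z V : B) :
    Summable fun n : ℕ => (n ! : ℂ)⁻¹ • powDeriv Z V n := by
  refine Summable.of_norm_bounded
    (g := fun n : ℕ => ‖(1 : B)‖ * ((2 * (‖Z‖ + ‖V‖)) ^ n / n !))
    ((Real.summable_pow_div_factorial _).mul_left _) fun n => ?_
  rw [norm_smul, norm_inv, Complex.norm_natCast]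
  have h1 := norm_powDeriv_le Z V n
  have h2 : (n : ℝ) ≤ 2 ^ n := by exact_mod_cast n.lt_two_pow_self.le
  have h3 : ‖(1 : B)‖ * (n * (‖Z‖ + ‖V‖) ^ n) ≤ ‖(1 : B)‖ * (2 * (‖Z‖ + ‖V‖)) ^ n := by
    rw [mul_pow]
    gcongr
  rw [← mul_div_assoc, div_eq_inv_mul]
  exact mul_le_mul_of_nonneg_left (h1.trans h3) (by positivity)

/-- The first order expansion of the exponential. -/
theorem exp_add_smul_isBigO (Z V : B) :
    (fun ε : ℂ => exp (Z + ε • V) - exp Z - ε • ∑' n : ℕ, (n ! : ℂ)⁻¹ • powDeriv Z V n)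
      =O[𝓝 0] fun ε => ε ^ 2 := by
  -- The 4 comes from n² ≤ 4ⁿ, which absorbs the quadratic factor into an exponential series.
  refine IsBigO.of_bound (‖(1 : B)‖ * Real.exp (4 * (‖Z‖ + ‖V‖))) ?_
  filter_upwards [Metric.closedBall_mem_nhds (0 : ℂ) one_pos] with ε hε
  have hε' : ‖ε‖ ≤ 1 := by simpa using hε
  have s1 : ∀ X : B, Summable fun n : ℕ => (n ! : ℂ)⁻¹ • X ^ n := fun X =>
    (norm_expSeries_summable' (𝕂 := ℂ) X).of_norm
  rw [exp_eq_tsum_complex, exp_eq_tsum_complex, ← (summable_powDeriv Z V).tsum_const_smul,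
    ← (s1 _).tsum_sub (s1 _), ← ((s1 _).sub (s1 _)).tsum_sub ((summable_powDeriv Z V).const_smul ε)]
  have hg : HasSum (fun n : ℕ => ‖ε‖ ^ 2 * (‖(1 : B)‖ * ((4 * (‖Z‖ + ‖V‖)) ^ n / n !)))
      (‖ε‖ ^ 2 * (‖(1 : B)‖ * Real.exp (4 * (‖Z‖ + ‖V‖)))) := by
    refine HasSum.mul_left _ (HasSum.mul_left _ ?_)
    have := NormedSpace.expSeries_div_hasSum_exp (4 * (‖Z‖ + ‖V‖))
    rwa [← Real.exp_eq_exp_ℝ] at this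
  refine (tsum_of_norm_bounded hg fun n => ?_).trans (le_of_eq ?_)
  · rw [smul_comm ε, ← smul_sub, ← smul_sub, norm_smul, norm_inv, Complex.norm_natCast]
    have h1 := norm_pow_add_sub_le Z V hε' n
    have h2 : (n : ℝ) ^ 2 ≤ 4 ^ n := by
      have : n ^ 2 ≤ (2 ^ n) ^ 2 := Nat.pow_le_pow_left n.lt_two_pow_self.le 2
      rw [← pow_mul, mul_comm n 2, pow_mul] at this
      exact_mod_cast this
    have h3 : ‖ε‖ ^ 2 * (‖(1 : B)‖ * ((n : ℝ) ^ 2 * (‖Z‖ + ‖V‖) ^ n)) ≤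
        ‖ε‖ ^ 2 * (‖(1 : B)‖ * (4 * (‖Z‖ + ‖V‖)) ^ n) := by
      rw [mul_pow]
      gcongr
    have h4 := mul_le_mul_of_nonneg_left (h1.trans h3) (by positivity : (0 : ℝ) ≤ (n ! : ℝ)⁻¹)
    refine h4.trans (le_of_eq ?_)
    ring
  · rw [norm_pow]
    ring

/-- A Cauchy product of absolutely convergent series; nilpotency of ad Z on V makes the second
factor a finite sum. -/
theorem tsum_powDeriv (Z V : B) (N : ℕ) (hN : ∀ q, N ≤ q → (negAd Z ^ q) V = 0) :
    ∑' n : ℕ, (n ! : ℂ)⁻¹ • powDeriv Z V n =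
      exp Z * ∑ q ∈ Finset.range N, ((q + 1)! : ℂ)⁻¹ • (negAd Z ^ q) V := by
  have h0 : ∀ q ∉ Finset.range N, ((q + 1)! : ℂ)⁻¹ • (negAd Z ^ q) V = 0 := by
    intro q hq
    rw [hN q (by simpa using hq), smul_zero]
  rw [← tsum_eq_sum (L := .unconditional ℕ) h0, exp_eq_tsum_complex,
    tsum_mul_tsum_eq_tsum_sum_range_of_summable_norm (norm_expSeries_summable' (𝕂 := ℂ) Z)
      (summable_of_ne_finset_zero (s := Finset.range N) fun q hq => by rw [h0 q hq, norm_zero]),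
    (summable_powDeriv Z V).tsum_eq_zero_add]
  simp only [powDeriv_expTerm]
  rw [powDeriv, smul_zero, zero_add]

theorem mul_exp_eq (Z V : B) (N : ℕ) (hN : ∀ q, N ≤ q → (negAd Z ^ q) V = 0) :
    V * exp Z = exp Z * ∑ q ∈ Finset.range N, (q ! : ℂ)⁻¹ • (negAd Z ^ q) V := by
  have h0 : ∀ q ∉ Finset.range N, (q ! : ℂ)⁻¹ • (negAd Z ^ q) V = 0 := by
    intro q hq
    rw [hN q (by simpa using hq), smul_zero]
  rw [← tsum_eq_sum (L := .unconditional ℕ) h0, exp_eq_tsum_complex,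
    ← (norm_expSeries_summable' (𝕂 := ℂ) Z).of_norm.tsum_mul_left,
    tsum_mul_tsum_eq_tsum_sum_range_of_summable_norm (norm_expSeries_summable' (𝕂 := ℂ) Z)
      (summable_of_ne_finset_zero (s := Finset.range N) fun q hq => by rw [h0 q hq, norm_zero])]
  simp only [mul_expTerm]

theorem exp_smul_isBigO (V : B) :
    (fun ε : ℂ => exp (ε • V) - 1 - ε • V) =O[𝓝 0] fun ε => ε ^ 2 := by
  have h := exp_add_smul_isBigO 0 V
  rw [tsum_powDeriv 0 V 1] at h
  · simpa using h
  · intro q hq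
    obtain ⟨q, rfl⟩ := Nat.exists_eq_add_of_le' hq
    rw [pow_succ, Module.End.mul_apply, negAd_apply, mul_zero, zero_mul, sub_zero, map_zero]

/-- The linearization of the equation `exp(εJ) exp(Z) = exp(Z + εV) exp(y(ε)) + O(ε²)`. -/
theorem exists_exp_isBigO_iff {Z V P A Φ : B} (hA : P * exp Z = exp Z * A)
    (hΦ : ∑' n : ℕ, (n ! : ℂ)⁻¹ • powDeriv Z V n = exp Z * Φ) (S : Submodule ℂ B)
    (hS : IsClosed (S : Set B)) :
    (∃ y : ℂ → B, (∀ ε, y ε ∈ S) ∧ Filter.Tendsto y (𝓝 0) (𝓝 0) ∧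
      (fun ε : ℂ => exp (ε • P) * exp Z - exp (Z + ε • V) * exp (y ε)) =O[𝓝 0]
        fun ε => ε ^ 2) ↔ A - Φ ∈ S := by
  have hinv : exp (-Z) * exp Z = 1 := by
    let _ : NormedAlgebra ℚ B := NormedAlgebra.restrictScalars ℚ ℂ B
    rw [← exp_add_of_commute (Commute.neg_left (Commute.refl Z)), neg_add_cancel, exp_zero]
  have hexp0 : HasFDerivAt (exp : B → B) (1 : B →L[ℂ] B) 0 := hasFDerivAt_exp_zero
  have hone : ∀ c : B, (fun _ : ℂ => c) =O[𝓝 0] fun _ => (1 : ℂ) := fun c =>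
    isBigO_const_const _ one_ne_zero _
  have hid : ∀ c : B, (fun ε : ℂ => ε • c) =O[𝓝 0] fun _ => (1 : ℂ) := fun c => by
    refine Filter.Tendsto.isBigO_one ℂ (c := (0 : ℂ) • c) ?_
    exact (continuous_id.smul continuous_const).tendsto 0
  have hsq : ∀ c : B, (fun ε : ℂ => ε ^ 2 • c) =O[𝓝 0] fun ε => ε ^ 2 := fun c => by
    have := (isBigO_refl (fun ε : ℂ => ε ^ 2) (𝓝 0)).smul (hone c)
    simpa using this
  -- products of bounded functions with `O(ε²)`
  have hmul : ∀ {f g : ℂ → B}, f =O[𝓝 0] (fun _ => (1 : ℂ)) → g =O[𝓝 0] (fun ε : ℂ => ε ^ 2) →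
      (fun ε => f ε * g ε) =O[𝓝 0] (fun ε : ℂ => ε ^ 2) := by
    intro f g hf hg
    simpa using hf.mul hg
  have hmul' : ∀ {f g : ℂ → B}, f =O[𝓝 0] (fun ε : ℂ => ε ^ 2) → g =O[𝓝 0] (fun _ => (1 : ℂ)) →
      (fun ε => f ε * g ε) =O[𝓝 0] (fun ε : ℂ => ε ^ 2) := by
    intro f g hf hg
    simpa using hf.mul hg
  have hr1 := exp_smul_isBigO P
  have hr2 := exp_add_smul_isBigO Z V
  rw [hΦ] at hr2
  -- bounded `exp (y ε)` and reduction to an equation near `1`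
  have hbdd : ∀ {y : ℂ → B}, Filter.Tendsto y (𝓝 0) (𝓝 0) →
      (fun ε => exp (y ε)) =O[𝓝 0] (fun _ => (1 : ℂ)) := by
    intro y hy
    exact (hexp0.continuousAt.tendsto.comp hy).isBigO_one ℂ
  -- Both exponentials depending linearly on ε are replaced by their first-order expansions, and the
  -- common factor e^Z is removed by multiplying with e^{-Z}.
  have hred : ∀ {y : ℂ → B}, Filter.Tendsto y (𝓝 0) (𝓝 0) →
      ((fun ε : ℂ => exp (ε • P) * exp Z - exp (Z + ε • V) * exp (y ε)) =O[𝓝 0]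
        (fun ε => ε ^ 2) ↔
      (fun ε : ℂ => (1 + ε • A) - (1 + ε • Φ) * exp (y ε)) =O[𝓝 0] fun ε => ε ^ 2) := by
    intro y hy
    have e : ∀ ε : ℂ, exp (ε • P) * exp Z - exp (Z + ε • V) * exp (y ε) =
        exp Z * ((1 + ε • A) - (1 + ε • Φ) * exp (y ε)) +
        ((exp (ε • P) - 1 - ε • P) * exp Z -
          (exp (Z + ε • V) - exp Z - ε • (exp Z * Φ)) * exp (y ε)) := by
      intro ε
      have hA' : exp Z * (ε • A) = ε • P * exp Z := by
        rw [mul_smul_comm, ← hA, smul_mul_assoc]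
      have hΦ' : ε • (exp Z * Φ) = exp Z * (ε • Φ) := (mul_smul_comm _ _ _).symm
      rw [hΦ']
      simp only [mul_sub, mul_add, sub_mul, add_mul, mul_one, one_mul, hA', mul_assoc]
      abel
    have hrem := (hmul' hr1 (hone (exp Z))).sub (hmul' hr2 (hbdd hy))
    constructor
    · intro h
      have h1 := hmul (hone (exp (-Z))) (h.sub hrem)
      refine h1.congr_left fun ε => ?_
      rw [e, add_sub_cancel_right, ← mul_assoc, hinv, one_mul]
    · intro h
      have h1 := (hmul (hone (exp Z)) h).add hrem
      exact h1.congr_left fun ε => (e ε).symm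
  constructor
  · rintro ⟨y, hyS, hy, h⟩
    rw [hred hy] at h
    -- 1 - εΦ inverts 1 + εΦ up to ε², which isolates exp(y) = 1 + ε(A - Φ) + O(ε²).
    have h1 : (fun ε : ℂ => (1 - ε • Φ) * ((1 + ε • A) - (1 + ε • Φ) * exp (y ε))) =O[𝓝 0]
        fun ε => ε ^ 2 := hmul ((hone 1).sub (hid Φ)) h
    have h2 : (fun ε : ℂ => exp (y ε) - 1 - ε • (A - Φ)) =O[𝓝 0] fun ε => ε ^ 2 := by
      have h3 := ((hmul' (hsq (Φ * Φ)) (hbdd hy)).sub (hsq (Φ * A))).sub h1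
      refine h3.congr_left fun ε => ?_
      simp only [mul_sub, mul_add, sub_mul, add_mul, mul_one, one_mul, smul_mul_assoc,
        mul_smul_comm, smul_smul, smul_sub, sq, mul_assoc]
      abel
    have hlin : (fun ε : ℂ => ε • (A - Φ)) =O[𝓝 0] fun ε : ℂ => ε := by
      have := (isBigO_refl (fun ε : ℂ => ε) (𝓝 0)).smul (hone (A - Φ))
      simpa using this
    have hsmall : (fun ε : ℂ => ε ^ 2) =o[𝓝 0] fun ε : ℂ => ε := by
      have := isLittleO_pow_id (𝕜 := ℂ) one_lt_two
      simpa using this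
    have h4 : (fun ε : ℂ => exp (y ε) - 1) =O[𝓝 0] fun ε : ℂ => ε := by
      have := (h2.trans hsmall.isBigO).add hlin
      simpa using this
    have h5 : (fun ε : ℂ => exp (y ε) - 1 - y ε) =o[𝓝 0] y := by
      have := hexp0.isLittleO.comp_tendsto hy
      simpa [Function.comp_def, exp_zero] using this
    -- A priori y only tends to 0. The derivative of exp at 0 is the identity, so y is equivalent to
    -- exp(y) - 1, which is O(ε).
    have h6 : y =O[𝓝 0] fun ε : ℂ => ε :=
      (IsEquivalent.isBigO_symm (u := fun ε : ℂ => exp (y ε) - 1) (v := y) h5).trans h4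
    have h7 : (fun ε : ℂ => y ε - ε • (A - Φ)) =o[𝓝 0] fun ε : ℂ => ε := by
      have := (h2.trans_isLittleO hsmall).sub (h5.trans_isBigO h6)
      refine this.congr_left fun ε => ?_
      abel
    have h8 : Filter.Tendsto (fun ε : ℂ => ε⁻¹ • y ε) (𝓝[≠] 0) (𝓝 (A - Φ)) := by
      rw [← tendsto_sub_nhds_zero_iff, ← isLittleO_one_iff ℂ]
      have h9 := ((isBigO_refl (fun ε : ℂ => ε⁻¹) (𝓝[≠] 0)).smul_isLittleO
        (h7.mono nhdsWithin_le_nhds))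
      refine h9.congr' ?_ ?_
      · filter_upwards [self_mem_nhdsWithin] with ε hε
        rw [smul_sub, smul_smul, inv_mul_cancel₀ hε, one_smul]
      · filter_upwards [self_mem_nhdsWithin] with ε hε
        rw [smul_eq_mul, inv_mul_cancel₀ hε]
    -- The quotients y(ε)/ε lie in S and converge to A - Φ; closedness of S is used here.
    exact hS.mem_of_tendsto h8 (Filter.Eventually.of_forall fun ε => S.smul_mem _ (hyS ε))
  · intro hW
    have hy : Filter.Tendsto (fun ε : ℂ => ε • (A - Φ)) (𝓝 0) (𝓝 0) := by
      have : Filter.Tendsto (fun ε : ℂ => ε • (A - Φ)) (𝓝 0) (𝓝 ((0 : ℂ) • (A - Φ))) :=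
        (continuous_id.smul continuous_const).tendsto 0
      rwa [zero_smul] at this
    refine ⟨fun ε => ε • (A - Φ), fun ε => S.smul_mem _ hW, hy, (hred hy).2 ?_⟩
    have h3 := ((hmul ((hone 1).add (hid Φ)) (exp_smul_isBigO (A - Φ))).add
      (hsq (Φ * (A - Φ)))).neg_left
    refine h3.congr_left fun ε => ?_
    simp only [mul_sub, add_mul, mul_one, one_mul, smul_mul_assoc,
      mul_smul_comm, smul_smul, smul_sub, sq, smul_add]
    abel

end Banach

/-! ### Finite-dimensional Lie algebras and linear groups -/

section FiniteDimensional

variable [Fintype Δ]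

variable (wt) in
/-- The filtration of `L` by the height of weights. -/
def heightFiltration (J : Module.Basis I ℂ L) (h₀ : ℤ) (n : ℕ) : Submodule ℂ L where
  carrier := {x | ∀ c, J.repr x c ≠ 0 → h₀ + n ≤ height (wt c)}
  zero_mem' := by simp
  add_mem' := by
    intro x y hx hy c hc
    by_cases h : J.repr x c = 0
    · exact hy c fun h' => hc (by simp [h, h'])
    · exact hx c h
  smul_mem' := by
    intro r x hx c hc
    exact hx c fun h' => hc (by simp [h'])

theorem IsRootBasis.lie_mem_heightFiltration (hJ : IsRootBasis J wt) (b : Pos wt) (h₀ : ℤ) (n : ℕ)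
    {x : L} (hx : x ∈ heightFiltration wt J h₀ n) :
    ⁅J b.1, x⁆ ∈ heightFiltration wt J h₀ (n + 1) := by
  rw [← J.linearCombination_repr x, Finsupp.linearCombination_apply, Finsupp.sum, lie_sum]
  refine Submodule.sum_mem _ fun c hc => ?_
  rw [lie_smul]
  refine Submodule.smul_mem _ _ fun d hd => ?_
  rw [hJ.wt_bracket _ _ _ hd, height_add]
  have h1 := hx c (Finsupp.mem_support_iff.1 hc)
  have h2 := height_pos b.2
  push_cast
  linarith

/-- The endomorphism `-ad (∑ z_α J_α)` of `L`. -/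
noncomputable def pointNegAd [Fintype (Pos wt)] (J : Module.Basis I ℂ L) (z : Pos wt → ℂ) :
    Module.End ℂ L :=
  -LieModule.toEnd ℂ L L (∑ α, z α • J α.1)

omit [Fintype Δ] in
theorem pointNegAd_apply [Fintype (Pos wt)] (z : Pos wt → ℂ) (x : L) :
    pointNegAd J z x = -∑ α : Pos wt, z α • ⁅J α.1, x⁆ := by
  simp [pointNegAd]

theorem IsRootBasis.pointNegAd_mem [Fintype (Pos wt)] (hJ : IsRootBasis J wt) (z : Pos wt → ℂ)
    (h₀ : ℤ) (n : ℕ) (x : L) (hx : x ∈ heightFiltration wt J h₀ n) :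
    pointNegAd J z x ∈ heightFiltration wt J h₀ (n + 1) := by
  rw [pointNegAd_apply]
  exact neg_mem (Submodule.sum_mem _ fun α _ =>
    Submodule.smul_mem _ _ (hJ.lie_mem_heightFiltration α h₀ n hx))

theorem IsRootBasis.chain_mem_heightFiltration (hJ : IsRootBasis J wt) {h₀ : ℤ} {x : L}
    (hx : x ∈ heightFiltration wt J h₀ 0) (l : List (Pos wt)) :
    chain J x l ∈ heightFiltration wt J h₀ l.length := by
  induction l using List.reverseRecOn with
  | nil => exact hx
  | append_singleton l b ih =>
    rw [chain_concat, List.length_append, List.length_singleton]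
    exact hJ.lie_mem_heightFiltration b h₀ _ ih

/-- Finitely many heights occur, so they lie between two bounds. Together with height-raising this
makes ad Z nilpotent. -/
theorem heightFiltration_bounds [Finite I] :
    ∃ h₀ : ℤ, ∃ N : ℕ, heightFiltration wt J h₀ 0 = ⊤ ∧
      ∀ n, N ≤ n → heightFiltration wt J h₀ n = ⊥ := by
  have hfin : (Set.range fun c => height (wt c)).Finite := Set.finite_range _
  obtain ⟨h₀, hh₀⟩ := hfin.bddBelow
  obtain ⟨h₁, hh₁⟩ := hfin.bddAbove
  refine ⟨h₀, (h₁ - h₀ + 1).toNat, ?_, fun n hn => ?_⟩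
  · ext x
    simp only [Submodule.mem_top, iff_true]
    intro c _
    simpa using hh₀ ⟨c, rfl⟩
  · rw [Submodule.eq_bot_iff]
    intro x hx
    refine J.repr.injective (Finsupp.ext fun c => ?_)
    by_contra h
    have h1 := hx c (by simpa using h)
    have h2 : height (wt c) ≤ h₁ := hh₁ ⟨c, rfl⟩
    omega

variable (wt) in
/-- The words of length `< N` in a finite alphabet. -/
noncomputable def shortWords [Fintype (Pos wt)] (N : ℕ) : Finset (List (Pos wt)) :=
  (List.finite_length_lt (Pos wt) N).toFinset

omit [Fintype Δ] in
theorem mem_shortWords [Fintype (Pos wt)] {N : ℕ} {l : List (Pos wt)} :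
    l ∈ shortWords wt N ↔ l.length < N := by
  rw [shortWords, Set.Finite.mem_toFinset]
  rfl

/-- The sum `∑ w(l) z_l [J_{l_k}, …, [J_{l_1}, x]]` over the words of length `< N`. -/
noncomputable def chainSum [Fintype (Pos wt)] (J : Module.Basis I ℂ L) (x : L) (z : Pos wt → ℂ)
    (N : ℕ) : (List (Pos wt) → ℂ) →ₗ[ℂ] L where
  toFun w := ∑ l ∈ shortWords wt N, (w l * (l.map z).prod) • chain J x l
  map_add' v w := by
    simp [add_smul, add_mul, Finset.sum_add_distrib]
  map_smul' r w := by
    simp [mul_smul, mul_assoc, Finset.smul_sum]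

omit [Fintype Δ] in
theorem chainSum_apply [Fintype (Pos wt)] (x : L) (z : Pos wt → ℂ) (N : ℕ)
    (w : List (Pos wt) → ℂ) : chainSum J x z N w =
      ∑ l ∈ shortWords wt N, (w l * (l.map z).prod) • chain J x l := rfl

-- Words outside either index set contribute zero, so the length cut-off can be exchanged for any
-- set carrying all nonzero terms.
omit [Fintype Δ] in
theorem chainSum_eq [Fintype (Pos wt)] {x : L} {N : ℕ}
    (hN : ∀ l : List (Pos wt), N ≤ l.length → chain J x l = 0) (z : Pos wt → ℂ)
    (w : List (Pos wt) → ℂ) {S : Finset (List (Pos wt))}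
    (hS : ∀ l, l ∉ S → w l = 0 ∨ chain J x l = 0) :
    chainSum J x z N w = ∑ l ∈ S, (w l * (l.map z).prod) • chain J x l := by
  classical
  have h0 : ∀ l, l ∉ shortWords wt N → (w l * (l.map z).prod) • chain J x l = 0 := by
    intro l hl
    rw [hN l (by simpa [mem_shortWords] using hl), smul_zero]
  have h1 : ∀ l, l ∉ S → (w l * (l.map z).prod) • chain J x l = 0 := by
    intro l hl
    rcases hS l hl with h | h <;> simp [h]
  rw [chainSum_apply, Finset.sum_subset (Finset.subset_union_left (s₂ := S)) fun l _ hl => h0 l hl,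
    ← Finset.sum_subset (Finset.subset_union_right (s₁ := shortWords wt N))
      fun l _ hl => h1 l hl]

omit [Fintype Δ] in
theorem chainSum_wordShift [Fintype (Pos wt)] {x : L} {N : ℕ}
    (hN : ∀ l : List (Pos wt), N ≤ l.length → chain J x l = 0) (z : Pos wt → ℂ)
    (w : List (Pos wt) → ℂ) :
    chainSum J x z N (wordShift _ w) = pointNegAd J z (chainSum J x z N w) := by
  -- The cut-off is raised by one to make room for the appended letter.
  rw [chainSum_eq hN z _ (S := shortWords wt (N + 1)) fun l hl =>
    Or.inr (hN l (by rw [mem_shortWords] at hl; omega)), pointNegAd_apply, chainSum_apply,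
    ← Finset.sum_neg_distrib]
  simp only [lie_sum, Finset.smul_sum, ← Finset.sum_neg_distrib]
  rw [Finset.sum_sigma']
  symm
  refine Finset.sum_of_injOn (fun p => p.2 ++ [p.1]) ?_ ?_ ?_ ?_
  · rintro ⟨α, l⟩ _ ⟨β, l'⟩ _ h
    obtain ⟨rfl, h2⟩ := List.append_inj' h rfl
    obtain rfl : α = β := by simpa using h2
    rfl
  · rintro ⟨α, l⟩ h
    simp only [Finset.mem_coe, Finset.mem_sigma, mem_shortWords] at h ⊢
    rw [List.length_append, List.length_singleton]
    omega
  · intro l hl hn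
    induction l using List.reverseRecOn with
    | nil => rw [wordShift_nil, zero_mul, zero_smul]
    | append_singleton l α _ =>
      refine absurd ⟨⟨α, l⟩, ?_, rfl⟩ hn
      rw [mem_shortWords, List.length_append, List.length_singleton] at hl
      simp only [Finset.mem_coe, Finset.mem_sigma, mem_shortWords]
      exact ⟨Finset.mem_univ _, by omega⟩
  · rintro ⟨α, l⟩ _
    simp only [wordShift_concat, chain_concat, lie_smul, List.map_append, List.prod_append,
      List.map_cons, List.map_nil, List.prod_singleton, smul_smul, neg_mul, neg_smul]
    congr 2
    ring

theorem IsRootBasis.chainSum_mem [Fintype (Pos wt)] (hJ : IsRootBasis J wt) {h₀ : ℤ} {x : L}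
    (hx : x ∈ heightFiltration wt J h₀ 0) (z : Pos wt → ℂ) (N n : ℕ)
    (w : List (Pos wt) → ℂ) (hw : w ∈ wordFiltration (Pos wt) n) :
    chainSum J x z N w ∈ heightFiltration wt J h₀ n := by
  refine Submodule.sum_mem _ fun l _ => ?_
  by_cases hl : l.length < n
  · rw [hw l hl, zero_mul, zero_smul]
    exact zero_mem _
  · refine Submodule.smul_mem _ _ fun c hc => ?_
    have := hJ.chain_mem_heightFiltration hx l c hc
    have h' : (n : ℤ) ≤ l.length := by exact_mod_cast not_lt.1 hl
    linarith

omit [Fintype Δ] in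
theorem chainSum_single [Fintype (Pos wt)] [DecidableEq (List (Pos wt))] {x : L} {N : ℕ}
    (hN : ∀ l : List (Pos wt), N ≤ l.length → chain J x l = 0) (z : Pos wt → ℂ) :
    chainSum J x z N (Pi.single [] 1) = x := by
  rw [chainSum_eq hN z _ (S := {[]}) fun l hl =>
    Or.inl (Pi.single_eq_of_ne (by simpa using hl) _)]
  simp [chain]

theorem IsRootBasis.eval_formula [Fintype (Pos wt)] (hJ : IsRootBasis J wt) (a : I) {N : ℕ}
    (hN : ∀ l : List (Pos wt), N ≤ l.length → chain J (J a) l = 0) (z : Pos wt → ℂ) (α : Pos wt) :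
    MvPolynomial.eval z (formula wt J a α) =
      J.repr (chainSum J (J a) z N (fieldWord wt a)) α.1 := by
  classical
  rw [chainSum_eq hN z _ (S := shortWords wt N ∪ (hJ.finite_tuples a α).toFinset) fun l hl =>
    Or.inr (hN l (by
      rw [Finset.mem_union, not_or, mem_shortWords] at hl
      exact not_lt.1 hl.1))]
  rw [formula, finsum_mem_eq_finite_toFinset_sum _ (hJ.finite_tuples a α), map_neg, map_sum,
    map_sum, Finsupp.finsetSum_apply, ← Finset.sum_neg_distrib]
  symm
  refine Finset.sum_subset_zero_on_sdiff Finset.subset_union_right ?_ ?_ |>.symm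
  · intro l hl
    rw [Finset.mem_sdiff, Set.Finite.mem_toFinset] at hl
    rw [map_smul, Finsupp.smul_apply, smul_eq_mul, mul_right_comm, hJ.repr_fieldWord_smul,
      if_neg hl.2, zero_mul]
  · intro l hl
    rw [Set.Finite.mem_toFinset] at hl
    rw [map_smul, Finsupp.smul_apply, smul_eq_mul, mul_right_comm, hJ.repr_fieldWord_smul,
      if_pos hl, term, map_mul, MvPolynomial.eval_C, map_list_prod, List.map_map, neg_mul]
    congr 3
    refine List.map_congr_left fun b _ => ?_
    simp

/-- Powers of X from the N-th on vanish, so the truncation at N is the exact sum of the series. -/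
theorem isSeriesApply_of_eventually_bot {F : ℕ → Submodule ℂ L} {X : Module.End ℂ L}
    (hX : ∀ n, ∀ f ∈ F n, X f ∈ F (n + 1)) (hF : F 0 = ⊤) {N : ℕ} (hN : ∀ n, N ≤ n → F n = ⊥)
    (hanti : Antitone F) (c : PowerSeries ℂ) (x : L) :
    IsSeriesApply F X c x (∑ k ∈ Finset.range N, PowerSeries.coeff k c • (X ^ k) x) := by
  intro K
  have hk : ∀ k, (X ^ k) x ∈ F k := fun k => pow_mem_filtration hX k 0 (by simp [hF])
  rcases le_total K N with h | h
  · rw [← Finset.sum_range_add_sum_Ico _ h, add_sub_cancel_left]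
    exact Submodule.sum_mem _ fun k hk' => Submodule.smul_mem _ _
      (hanti (Finset.mem_Ico.1 hk').1 (hk k))
  · rw [← Finset.sum_range_add_sum_Ico _ h, sub_add_cancel_left]
    refine neg_mem (Submodule.sum_mem _ fun k hk' => Submodule.smul_mem _ _ ?_)
    have := hk k
    rw [hN k (Finset.mem_Ico.1 hk').1, Submodule.mem_bot] at this
    rw [this]
    exact zero_mem _

theorem heightFiltration_antitone (h₀ : ℤ) : Antitone (heightFiltration wt J h₀) := by
  intro m n hmn x hx c hc
  have := hx c hc
  have h : (m : ℤ) ≤ n := by exact_mod_cast hmn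
  linarith

omit [Fintype Δ] in
theorem map_pointNegAd_pow [Fintype (Pos wt)] {A : Type*} [Ring A] [Algebra ℂ A]
    (ρ : L →ₗ⁅ℂ⁆ A) (z : Pos wt → ℂ) (q : ℕ) (x : L) :
    ρ ((pointNegAd J z ^ q) x) = (negAd (ρ (∑ α, z α • J α.1)) ^ q) (ρ x) := by
  induction q with
  | zero => simp
  | succ q ih =>
    rw [pow_succ', pow_succ', Module.End.mul_apply, Module.End.mul_apply, ← ih, negAd_apply]
    change ρ (-⁅_, _⁆) = _
    rw [map_neg, LieHom.map_lie, LieRing.of_associative_ring_bracket, neg_sub]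

/-- The components in linear groups. -/
theorem IsRootBasis.isCoordShift_iff [Fintype (Pos wt)] (hJ : IsRootBasis J wt) (a : I)
    [Module.Finite ℂ L] {A : Type*} [NormedRing A] [NormedAlgebra ℂ A] [CompleteSpace A]
    (ρ : L →ₗ⁅ℂ⁆ A) (hρ : Function.Injective ρ) (z v : Pos wt → ℂ) :
    IsCoordShift J ρ a z v ↔ ∀ α, v α = MvPolynomial.eval z (formula wt J a α) := by
  classical
  have : Finite I := Module.Finite.finite_basis J
  obtain ⟨h₀, N, hF0, hFN⟩ := heightFiltration_bounds (J := J) (wt := wt)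
  set F := heightFiltration wt J h₀
  have hx : ∀ x, x ∈ F 0 := fun x => by simp [hF0]
  have hN : ∀ l : List (Pos wt), N ≤ l.length → chain J (J a) l = 0 := by
    intro l hl
    have := hJ.chain_mem_heightFiltration (hx (J a)) l
    rwa [show heightFiltration wt J h₀ l.length = ⊥ from hFN _ hl, Submodule.mem_bot] at this
  set X := pointNegAd J z with hXdef
  have hX := hJ.pointNegAd_mem z h₀
  have hXN : ∀ q, N ≤ q → ∀ x, (X ^ q) x = 0 := by
    intro q hq x
    have h1 : (X ^ q) x ∈ F (q + 0) := pow_mem_filtration hX q 0 (hx x)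
    rwa [add_zero, hFN q hq, Submodule.mem_bot] at h1
  have hF' : ∀ x, (∀ K, x ∈ F K) → x = 0 := by
    intro x h
    have := h N
    rwa [hFN N le_rfl, Submodule.mem_bot] at this
  set T := chainSum J (J a) z N
  set V : L := ∑ α, v α • J α.1 with hV
  have hA : IsSeriesApply F X expSeries (J a) (T (expWord _)) := by
    have := (isSeriesApply_expWord (Pos wt)).map T (hJ.chainSum_mem (hx (J a)) z N)
      (chainSum_wordShift hN z)
    rwa [show T (Pi.single [] 1) = J a from chainSum_single hN z] at this
  have hU : IsSeriesApply F X todd (T (posExpWord wt a)) (T (fieldWord wt a)) :=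
    (isSeriesApply_fieldWord a).map T (hJ.chainSum_mem (hx (J a)) z N) (chainSum_wordShift hN z)
  have hser := fun c x => isSeriesApply_of_eventually_bot hX hF0 hFN
    (heightFiltration_antitone h₀) c x
  have hA' := hA.eq hF' (hser _ _)
  have hΦ := hser expQuotSeries V
  set Φ := ∑ k ∈ Finset.range N, PowerSeries.coeff k expQuotSeries • (X ^ k) V with hΦdef
  have hVrepr : ∀ α : Pos wt, J.repr V α.1 = v α := by
    intro α
    rw [hV, map_sum, Finsupp.finsetSum_apply, Finset.sum_eq_single α]
    · simp
    · intro β _ hβ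
      have : (β : I) ≠ α := fun h => hβ (Subtype.ext h)
      simp [this]
    · simp
  have hPV : posProj wt J V = V := by
    rw [hV, map_sum]
    refine Finset.sum_congr rfl fun α _ => ?_
    rw [map_smul, posProj, J.constr_basis, if_pos α.2]
  have hpow : ∀ n, posProj wt J ((X ^ n) V) = (X ^ n) V := by
    intro n
    induction n with
    | zero => exact hPV
    | succ n ih =>
      rw [pow_succ', Module.End.mul_apply, hXdef, pointNegAd_apply, map_neg, map_sum]
      refine congrArg _ (Finset.sum_congr rfl fun α _ => ?_)
      rw [map_smul, hJ.posProj_lie α ih]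
  have hPΦ : posProj wt J Φ = Φ := by
    simp only [hΦdef, map_sum, map_smul, hpow]
  have hPA : posProj wt J (T (expWord _)) = T (posExpWord wt a) := by
    simp only [T, chainSum_apply, map_sum, map_smul, mul_comm _ (List.prod _), mul_smul,
      hJ.posProj_chain]
  have hPU : posProj wt J (T (fieldWord wt a)) = T (fieldWord wt a) := by
    simp only [T, chainSum_apply, map_sum, map_smul, mul_comm _ (List.prod _), mul_smul,
      hJ.posProj_fieldWord]
  -- The Banach algebra criterion is applied to S = ρ(𝔟⁻), closed because finite-dimensional;
  -- injectivity of ρ pulls the condition back to the Lie algebra.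
  have hgroup : IsCoordShift J ρ a z v ↔ T (expWord _) - Φ ∈ nonposSubmodule wt J := by
    have hE := mul_exp_eq (ρ (∑ α, z α • J α.1)) (ρ (J a)) N fun q hq => by
      rw [← map_pointNegAd_pow, hXN q hq, map_zero]
    have hD := tsum_powDeriv (ρ (∑ α, z α • J α.1)) (ρ V) N fun q hq => by
      rw [← map_pointNegAd_pow, hXN q hq, map_zero]
    have e1 : ∑ q ∈ Finset.range N, (q ! : ℂ)⁻¹ • (negAd (ρ (∑ α, z α • J α.1)) ^ q) (ρ (J a)) =
        ρ (T (expWord _)) := by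
      rw [hA']
      refine Eq.trans ?_ (map_sum ρ _ _).symm
      refine Finset.sum_congr rfl fun q _ => ?_
      rw [map_smul, map_pointNegAd_pow, expSeries, PowerSeries.coeff_mk]
    have e2 : ∑ q ∈ Finset.range N,
        ((q + 1)! : ℂ)⁻¹ • (negAd (ρ (∑ α, z α • J α.1)) ^ q) (ρ V) = ρ Φ := by
      rw [hΦdef]
      refine Eq.trans ?_ (map_sum ρ _ _).symm
      refine Finset.sum_congr rfl fun q _ => ?_
      rw [map_smul, map_pointNegAd_pow, expQuotSeries, PowerSeries.coeff_mk]
    rw [e1] at hE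
    rw [e2] at hD
    have hmain := exists_exp_isBigO_iff hE hD ((nonposSubmodule wt J).map (ρ : L →ₗ[ℂ] A))
      (Submodule.closed_of_finiteDimensional _)
    have hmem : ρ (T (expWord _)) - ρ Φ ∈ (nonposSubmodule wt J).map (ρ : L →ₗ[ℂ] A) ↔
        T (expWord _) - Φ ∈ nonposSubmodule wt J := by
      rw [← map_sub]
      constructor
      · rintro ⟨w, hw, h⟩
        rwa [← hρ h]
      · intro h
        exact ⟨_, h, rfl⟩
    rw [← hmem, ← hmain]
    have hexp : ∀ ε : ℂ, ρ (∑ α, (z α + ε * v α) • J α.1) =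
        ρ (∑ α, z α • J α.1) + ε • ρ V := by
      intro ε
      rw [← map_smul, ← map_add, hV, Finset.smul_sum, ← Finset.sum_add_distrib]
      simp only [add_smul, mul_smul]
    rw [IsCoordShift]
    simp only [hexp, ← nonposSubmodule_eq_span]
    constructor
    · rintro ⟨y, h1, h2, h3⟩
      exact ⟨fun ε => ρ (y ε), fun ε => ⟨y ε, h1 ε, rfl⟩, h2, h3⟩
    · rintro ⟨y, h1, h2, h3⟩
      choose y' hy' hy'' using h1
      obtain rfl : (fun ε => ρ (y' ε)) = y := funext hy''
      exact ⟨y', hy', h2, h3⟩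
  -- From here on the algebra is that of the formal case, with the filtration by height in place of
  -- the one by degree.
  rw [hgroup, nonposSubmodule, LinearMap.mem_ker, map_sub, hPΦ, hPA, sub_eq_zero, eq_comm,
    IsSeriesApply.eq_iff hX hF0 hF' todd_mul_expQuotSeries hΦ hU]
  constructor
  · intro h α
    rw [hJ.eval_formula a hN, ← hVrepr, h]
  · intro h
    refine J.repr.injective (Finsupp.ext fun c => ?_)
    by_cases hc : 0 < wt c
    · have := h ⟨c, hc⟩
      rwa [hJ.eval_formula a hN, ← hVrepr] at this
    · rw [← hPV, ← hPU, repr_posProj, repr_posProj, if_neg hc, if_neg hc]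

end FiniteDimensional

end CoadjointOrbit

open CoadjointOrbit in
theorem proposition3 {L : Type*} [LieRing L] [LieAlgebra ℂ L] {I Δ : Type*} [Finite Δ]
    (J : Module.Basis I ℂ L) (wt : I → Δ → ℤ) (hJ : IsRootBasis J wt) (a : I) :
    -- the sums in the closed formula are finite, and `λ ≤ k` is well defined on them
    (∀ α : Pos wt, (tuples wt a α).Finite ∧
      ∀ l ∈ tuples wt a α, IsLeast {s : ℕ | 0 < totalWeight wt a (l.take s)} (crossing wt a l) ∧
        crossing wt a l ≤ l.length) ∧
    -- the components of the vector field are given by the closed formula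
    (∀ u : Pos wt → MvPowerSeries (Pos wt) ℂ,
      IsFieldComponents J a u ↔ ∀ α, u α = (formula wt J a α : MvPolynomial (Pos wt) ℂ)) ∧
    -- the resulting formula for the vector field `ξ_a`
    (∀ u : Pos wt → MvPowerSeries (Pos wt) ℂ, IsFieldComponents J a u →
      ∀ p : MvPolynomial (Pos wt) ℂ,
        {q : List (Pos wt) × Pos wt | q.1 ∈ tuples wt a q.2 ∧
          term J a q.1 q.2 * MvPolynomial.pderiv q.2 p ≠ 0}.Finite ∧
        vectorField u p =
          ((∑ᶠ q ∈ {q : List (Pos wt) × Pos wt | q.1 ∈ tuples wt a q.2},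
            term J a q.1 q.2 * MvPolynomial.pderiv q.2 p : MvPolynomial (Pos wt) ℂ) :
            MvPowerSeries (Pos wt) ℂ)) ∧
    -- the same components for every linear group with finite-dimensional Lie algebra `L`,
    -- at every point of the coordinate system
    (∀ [Fintype (Pos wt)] [Module.Finite ℂ L] {A : Type*} [NormedRing A] [NormedAlgebra ℂ A]
      [CompleteSpace A] (ρ : L →ₗ⁅ℂ⁆ A), Function.Injective ρ →
      ∀ z v : Pos wt → ℂ,
        IsCoordShift J ρ a z v ↔ ∀ α, v α = MvPolynomial.eval z (formula wt J a α)) := by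
  exact ⟨fun α => ⟨hJ.finite_tuples a α, fun _ hl => isLeast_crossing hl⟩,
    hJ.isFieldComponents_iff_formula a,
    fun u hu p => hJ.vectorField_eq a ((hJ.isFieldComponents_iff_formula a u).1 hu) p, by
      intro _ _ A _ _ _ ρ hρ z v
      cases nonempty_fintype Δ
      exact hJ.isCoordShift_iff a ρ hρ z v⟩
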